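/- Let $\lambda,\mu\in\mathbb R$ with $\mu\ge 0$ and $3\lambda+2\mu>0$. Set $\widehat w(\delta,\eta)=\mathcal W(\eta^{1/3},\delta/\eta)$ for $\delta,\eta>0$, where $$\mathcal W(x,y)=x^{-4}\Big(\tfrac18(\lambda+2\mu)y^{-4}+\tfrac12\lambda y^{-2}+\tfrac12(\lambda+\mu)\Big)-x^{-2}\Big(\tfrac14(3\lambda+2\mu)y^{-2}+\tfrac12(3\lambda+2\mu)\Big)+\tfrac38(3\lambda+2\mu)$$ is the Saint Venant–Kirchhoff stored energy, and let $\widehat p_{\rm rad}=\delta^2\partial_\delta\widehat w$, $\widehat p_{\rm tan}=\widehat p_{\rm rad}+\tfrac32\delta\eta\,\partial_\eta\widehat w$. A triple $(\rho,p_{\rm rad},p_{\rm tan})$ of functions on $[0,\infty)$ is a *regular ball* with radius $R>0$ and reference density $\mathcal K>0$ if the interior of $\{r>0:\rho(r)>0\}$ is $(0,R)$; $\rho,p_{\rm rad},p_{\rm tan}\in C^0([0,R])\cap C^1((0,R])$; with $m(r)=4\pi\int_0^r\rho(s)s^2\,ds$, $$\frac{dp_{\rm rad}}{dr}=-\frac2r(p_{\rm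 rad}-p_{\rm tan})-\rho\frac{d\Phi}{dr},\qquad \frac{d\Phi}{dr}=\frac{m}{r^2}\qquad\text{on }(0,R)$$ for some function $\Phi$; $p_{\rm rad},p_{\rm tan}>0$ on $[0,R)$; $p_{\rm rad}(R)=0$; $p_{\rm rad}(0)=p_{\rm tan}(0)$; $\rho=p_{\rm rad}=p_{\rm tan}=0$ on $(R,\infty)$; and on $(0,R)$ the constitutive relations $p_{\rm rad}=\widehat p_{\rm rad}(\delta,\eta)$, $p_{\rm tan}=\widehat p_{\rm tan}(\delta,\eta)$ hold, where $\delta(r)=\rho(r)/\mathcal K$ and $\eta(r)=m(r)/(\tfrac{4\pi}3\mathcal K r^3)$. It is *strongly regular* if moreover $\rho,p_{\rm rad},p_{\rm tan}\in C^1([0,R])$ and $\rho',p_{\rm rad}',p_{\rm tan}'\to0$ as $r\to0^+$. Let $$\Delta_\flat=\Big(\frac{5\lambda+6\mu}{3\lambda+2\mu}\Big)^{3/2}.$$ Then: 1. Every regular ball with reference density $\mathcal K>0$ satisfies $\delta_c:=\rho(0)/\mathcal K>1$. 2. If $\rho_c,\mathcal K>0$, $\delta_c=\rho_c/\mathcal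 K$ and $\partial_\delta\widehat p_{\rm rad}(\delta_c,\delta_c)>0$ (strict hyperbolicity at the center), then $\delta_c<\Delta_\flat$. 3. If $\rho_c,\mathcal K>0$ and $1<\delta_c=\rho_c/\mathcal K<\Delta_\flat$, then $\partial_\delta\widehat p_{\rm rad}(\delta_c,\delta_c)>0$ and there is a strongly regular ball with reference density $\mathcal K$ and $\rho(0)=\rho_c$; it is unique, even among all regular balls with reference density $\mathcal K$ and central density $\rho_c$. With $R$ its radius, for all $r\in(0,R]$, $$\partial_\delta\widehat p_{\rm rad}(\delta(r),\eta(r))>0,\quad \rho(r)<\rho_c,\quad \tfrac{4\pi}3\max(\rho(r),\mathcal K)\,r^3<m(r)<\tfrac{4\pi}3\rho_c r^3.$$ -/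

import Mathlib

open Set Filter Topology

noncomputable section

namespace ElasticBall

/-- Mass enclosed in the ball of radius `r` for a radial mass density `rho`. -/
def mass (rho : ℝ → ℝ) (r : ℝ) : ℝ :=
  4 * Real.pi * ∫ s in (0 : ℝ)..r, rho s * s ^ 2

/-- The relative density `δ(r) = ρ(r) / K`, where `K` is the reference density. -/
def delta (K : ℝ) (rho : ℝ → ℝ) (r : ℝ) : ℝ := rho r / K

/-- The relative mean density `η(r) = m(r) / ((4π/3) K r³)`, for `r > 0`.
(For a density that is continuous at the center it tends to `δ(0)` as `r → 0⁺`.) -/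
def eta (K : ℝ) (rho : ℝ → ℝ) (r : ℝ) : ℝ :=
  mass rho r / (4 * Real.pi / 3 * K * r ^ 3)

/-- The static, spherically symmetric Euler-Poisson system at the radii `0 < r < R`,
with Newtonian potential `Φ`. -/
def SolvesStaticSystem (rho pRad pTan : ℝ → ℝ) (R : ℝ) : Prop :=
  ∃ Phi : ℝ → ℝ, ∀ r ∈ Ioo 0 R,
    HasDerivAt Phi (mass rho r / r ^ 2) r ∧
    HasDerivAt pRad (-(2 / r) * (pRad r - pTan r) - rho r * deriv Phi r) r

/-- `(rho, pRad, pTan)` is a regular static self-gravitating ball of matter of radius `R`.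
Only the values at radii `r ≥ 0` matter. -/
structure IsRegularBall (rho pRad pTan : ℝ → ℝ) (R : ℝ) : Prop where
  radius_pos : 0 < R
  support_eq : interior {r : ℝ | 0 < r ∧ 0 < rho r} = Ioo 0 R
  rho_cont : ContinuousOn rho (Icc 0 R)
  pRad_cont : ContinuousOn pRad (Icc 0 R)
  pTan_cont : ContinuousOn pTan (Icc 0 R)
  rho_C1 : ContDiffOn ℝ 1 rho (Ioc 0 R)
  pRad_C1 : ContDiffOn ℝ 1 pRad (Ioc 0 R)
  pTan_C1 : ContDiffOn ℝ 1 pTan (Ioc 0 R)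
  system : SolvesStaticSystem rho pRad pTan R
  pRad_pos : ∀ r ∈ Ico 0 R, 0 < pRad r
  pTan_pos : ∀ r ∈ Ico 0 R, 0 < pTan r
  pRad_boundary : pRad R = 0
  center_eq : pRad 0 = pTan 0
  vacuum : ∀ r, R < r → rho r = 0 ∧ pRad r = 0 ∧ pTan r = 0

/-- Strongly regular balls: the fields are `C¹` up to the center and their radial derivatives
tend to `0` there. -/
structure IsStronglyRegularBall (rho pRad pTan : ℝ → ℝ) (R : ℝ) : Prop
    extends IsRegularBall rho pRad pTan R where
  rho_C1_closed : ContDiffOn ℝ 1 rho (Icc 0 R)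
  pRad_C1_closed : ContDiffOn ℝ 1 pRad (Icc 0 R)
  pTan_C1_closed : ContDiffOn ℝ 1 pTan (Icc 0 R)
  rho_deriv_center : Tendsto (deriv rho) (𝓝[>] 0) (𝓝 0)
  pRad_deriv_center : Tendsto (deriv pRad) (𝓝[>] 0) (𝓝 0)
  pTan_deriv_center : Tendsto (deriv pTan) (𝓝[>] 0) (𝓝 0)

/-- The pressures are given by the `C¹` constitutive functions `cRad, cTan` of `(δ, η)` in the
interior `(0, R)` of the matter support, where `δ, η > 0`. (By continuity the relations then
hold also in the limits `r → 0` and `r → R`, wherever `δ` and `η` have positive limits.) -/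
structure HasConstitutiveFunctions (cRad cTan : ℝ → ℝ → ℝ) (K : ℝ)
    (rho pRad pTan : ℝ → ℝ) (R : ℝ) : Prop where
  cRad_C1 : ContDiffOn ℝ 1 (fun q : ℝ × ℝ => cRad q.1 q.2) (Ioi 0 ×ˢ Ioi 0)
  cTan_C1 : ContDiffOn ℝ 1 (fun q : ℝ × ℝ => cTan q.1 q.2) (Ioi 0 ×ˢ Ioi 0)
  pRad_eq : ∀ r ∈ Ioo 0 R, pRad r = cRad (delta K rho r) (eta K rho r)
  pTan_eq : ∀ r ∈ Ioo 0 R, pTan r = cTan (delta K rho r) (eta K rho r)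

/-- Radial constitutive function of the hyperelastic material with stored energy `w(δ, η)`:
`δ² ∂_δ w`. -/
def hyperRad (w : ℝ → ℝ → ℝ) (d e : ℝ) : ℝ :=
  d ^ 2 * deriv (fun s => w s e) d

/-- Tangential constitutive function of the hyperelastic material with stored energy `w(δ, η)`:
the radial one plus `(3/2) δ η ∂_η w`. -/
def hyperTan (w : ℝ → ℝ → ℝ) (d e : ℝ) : ℝ :=
  hyperRad w d e + 3 / 2 * d * e * deriv (fun t => w d t) e

/-- The Saint Venant-Kirchhoff stored energy with Lamé coefficients `lam, mu`, in the variables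
`x = η^(1/3)`, `y = δ / η`. -/
def svkW (lam mu x y : ℝ) : ℝ :=
  x ^ (-4 : ℤ) * (1 / 8 * (lam + 2 * mu) * y ^ (-4 : ℤ) + 1 / 2 * lam * y ^ (-2 : ℤ)
      + 1 / 2 * (lam + mu))
    + x ^ (-2 : ℤ) * (-(1 / 4) * (3 * lam + 2 * mu) * y ^ (-2 : ℤ)
      - 1 / 2 * (3 * lam + 2 * mu))
    + 3 / 8 * (3 * lam + 2 * mu)

/-- The Saint Venant-Kirchhoff stored energy as a function of `(δ, η)`. -/
def svkEnergy (lam mu d e : ℝ) : ℝ := svkW lam mu (e ^ (1 / 3 : ℝ)) (d / e)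

/-- Radial constitutive function of the Saint Venant-Kirchhoff material. -/
def svkRad (lam mu : ℝ) : ℝ → ℝ → ℝ := hyperRad (svkEnergy lam mu)

/-- Tangential constitutive function of the Saint Venant-Kirchhoff material. -/
def svkTan (lam mu : ℝ) : ℝ → ℝ → ℝ := hyperTan (svkEnergy lam mu)

/-- Strict hyperbolicity at the state `(δ, η) = (d, e)`: `∂_δ cRad (d, e) > 0`.
At the center of a ball the state is `(δ_c, δ_c)`. -/
def StrictlyHyperbolicAt (cRad : ℝ → ℝ → ℝ) (d e : ℝ) : Prop :=
  0 < deriv (fun s => cRad s e) d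

/-- A regular static self-gravitating Saint Venant-Kirchhoff ball of radius `R` with reference
density `K`. -/
def IsRegularSVKBall (lam mu K : ℝ) (rho pRad pTan : ℝ → ℝ) (R : ℝ) : Prop :=
  IsRegularBall rho pRad pTan R ∧
    HasConstitutiveFunctions (svkRad lam mu) (svkTan lam mu) K rho pRad pTan R

/-- A strongly regular static self-gravitating Saint Venant-Kirchhoff ball of radius `R` with
reference density `K`. -/
def IsStronglyRegularSVKBall (lam mu K : ℝ) (rho pRad pTan : ℝ → ℝ) (R : ℝ) : Prop :=
  IsStronglyRegularBall rho pRad pTan R ∧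
    HasConstitutiveFunctions (svkRad lam mu) (svkTan lam mu) K rho pRad pTan R

/-- The critical value `Δ_♭ = ((5λ + 6μ) / (3λ + 2μ))^(3/2)`. -/
def deltaFlat (lam mu : ℝ) : ℝ :=
  ((5 * lam + 6 * mu) / (3 * lam + 2 * mu)) ^ (3 / 2 : ℝ)

end ElasticBall

end

/-! In terms of the radial and tangential stretches `a, b`, with `δ = 1 / (a b²)` and
`η = 1 / b³`, the static equations become a first order system which is singular at the center.
Along a solution starting at `a = b = β` with `β < 1` and positive radial modulus, the gap `a - b`
is positive and `b` increases, so hyperbolicity is preserved. Dividing the gap by `r` gives a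
system of Briot-Bouquet type, for which the Cauchy problem at the center is solved by Picard
iteration and has a unique solution; truncating the field outside the region given by the a priori
bounds makes the solution global. The same bounds force the radial pressure to vanish at a finite
radius, which is the radius of the ball. -/

noncomputable section

namespace ElasticBall

section Calculus

lemma tendsto_nhdsGT_of_continuousOn_Icc {E : Type*} [TopologicalSpace E] {f : ℝ → E} {a b : ℝ}
    (hab : a < b) (hf : ContinuousOn f (Icc a b)) : Tendsto f (𝓝[>] a) (𝓝 (f a)) :=
  (hf a (left_mem_Icc.2 hab.le)).mono_left <|
    nhdsWithin_le_iff.2 (Icc_mem_nhdsGT hab)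

lemma le_of_tendsto_nhdsGT_of_deriv_nonpos {f f' : ℝ → ℝ} {a b l : ℝ}
    (hf : ∀ r ∈ Ioo a b, HasDerivAt f (f' r) r) (hf' : ∀ r ∈ Ioo a b, f' r ≤ 0)
    (hl : Tendsto f (𝓝[>] a) (𝓝 l)) : ∀ r ∈ Ioo a b, f r ≤ l := by
  intro r hr
  have hanti : AntitoneOn f (Ioo a b) := by
    refine antitoneOn_of_deriv_nonpos (convex_Ioo a b)
      (fun s hs => (hf s hs).continuousAt.continuousWithinAt) ?_ ?_ <;> rw [interior_Ioo]
    · exact fun s hs => (hf s hs).differentiableAt.differentiableWithinAt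
    · exact fun s hs => (hf s hs).deriv ▸ hf' s hs
  refine ge_of_tendsto hl ?_
  filter_upwards [Ioo_mem_nhdsGT hr.1] with s hs
  exact hanti ⟨hs.1, hs.2.trans hr.2⟩ hr hs.2.le

lemma lt_of_tendsto_nhdsGT_of_deriv_pos {f f' : ℝ → ℝ} {a b l : ℝ}
    (hf : ∀ r ∈ Ioo a b, HasDerivAt f (f' r) r) (hf' : ∀ r ∈ Ioo a b, 0 < f' r)
    (hl : Tendsto f (𝓝[>] a) (𝓝 l)) : ∀ r ∈ Ioo a b, l < f r := by
  intro r hr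
  have hmono : StrictMonoOn f (Ioo a b) := by
    refine strictMonoOn_of_deriv_pos (convex_Ioo a b)
      (fun s hs => (hf s hs).continuousAt.continuousWithinAt) ?_
    rw [interior_Ioo]
    exact fun s hs => (hf s hs).deriv ▸ hf' s hs
  obtain ⟨s, has, hsr⟩ := exists_between hr.1
  have hs : s ∈ Ioo a b := ⟨has, hsr.trans hr.2⟩
  refine lt_of_le_of_lt (le_of_tendsto hl ?_) (hmono hs hr hsr)
  filter_upwards [Ioo_mem_nhdsGT has] with t ht
  exact (hmono ⟨ht.1, ht.2.trans hs.2⟩ hs ht.2).le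

lemma nonpos_of_deriv_le_mul {f f' : ℝ → ℝ} {a b k : ℝ}
    (hf : ∀ r ∈ Ioo a b, HasDerivAt f (f' r) r) (hf' : ∀ r ∈ Ioo a b, f' r ≤ k * f r)
    (hl : Tendsto f (𝓝[>] a) (𝓝 0)) : ∀ r ∈ Ioo a b, f r ≤ 0 := by
  intro r hr
  have hexp : ∀ s, HasDerivAt (fun s => Real.exp (-(k * s))) (Real.exp (-(k * s)) * -k) s :=
    fun s => by simpa using ((hasDerivAt_id s).const_mul k).neg.exp
  have hlim : Tendsto (fun s => Real.exp (-(k * s)) * f s) (𝓝[>] a) (𝓝 0) := by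
    simpa using ((hexp a).continuousAt.tendsto.mono_left nhdsWithin_le_nhds).mul hl
  have hle := le_of_tendsto_nhdsGT_of_deriv_nonpos
    (fun s hs => (hexp s).mul (hf s hs))
    (fun s hs => by nlinarith [Real.exp_pos (-(k * s)), hf' s hs]) hlim r hr
  exact nonpos_of_mul_nonpos_right hle (Real.exp_pos _)

lemma exists_first_zero {f : ℝ → ℝ} {a b : ℝ} (hf : ContinuousOn f (Icc a b)) (ha : f a < 0)
    (hb : ∃ r ∈ Icc a b, 0 ≤ f r) : ∃ r ∈ Ioc a b, f r = 0 ∧ ∀ s ∈ Ico a r, f s < 0 := by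
  obtain ⟨r, ⟨hr, hfr⟩, hleast⟩ :=
    (isCompact_Icc.of_isClosed_subset (hf.preimage_isClosed_of_isClosed isClosed_Icc isClosed_Ici)
      inter_subset_left).exists_isLeast (hb.imp fun _ h => h)
  have hneg : ∀ s ∈ Ico a r, f s < 0 := fun s hs => by
    by_contra! h
    exact hs.2.not_ge (hleast ⟨⟨hs.1, hs.2.le.trans hr.2⟩, h⟩)
  have har : a < r := hr.1.lt_of_ne (by rintro rfl; exact ha.not_ge hfr)
  refine ⟨r, ⟨har, hr.2⟩, le_antisymm ?_ hfr, hneg⟩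
  obtain ⟨s, hs, hfs⟩ :=
    intermediate_value_Icc har.le (hf.mono (Icc_subset_Icc_right hr.2)) ⟨ha.le, hfr⟩
  rcases hs.2.eq_or_lt with rfl | hsr
  · exact hfs.le
  · exact absurd hfs (hneg s ⟨hs.1, hsr⟩).ne

/-- Continuity argument: since `g` cannot take values in `(0, δ)` before its first zero, it has
no zero at all. -/
lemma forall_le_of_gap {g : ℝ → ℝ} {a b δ : ℝ} (hg : ContinuousOn g (Ioo a b)) (hδ : 0 < δ)
    (hpos : ∀ᶠ r in 𝓝[>] a, 0 < g r)
    (hgap : ∀ r ∈ Ioo a b, (∀ s ∈ Ioo a r, 0 < g s) → ∀ s ∈ Ioo a r, δ ≤ g s) :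
    ∀ r ∈ Ioo a b, δ ≤ g r := by
  suffices hall : ∀ r ∈ Ioo a b, 0 < g r by
    intro r hr
    obtain ⟨t, hrt, htb⟩ := exists_between hr.2
    exact hgap t ⟨hr.1.trans hrt, htb⟩ (fun s hs => hall s ⟨hs.1, hs.2.trans htb⟩) r ⟨hr.1, hrt⟩
  by_contra! ⟨r, hr, hgr⟩
  obtain ⟨u, hau, hu⟩ := mem_nhdsGT_iff_exists_Ioo_subset.1 hpos
  have hau : a < u := hau
  obtain ⟨v, hav, hv⟩ := exists_between (lt_min hau hr.1)
  have hgv : ∀ s ∈ Ioc a v, 0 < g s := fun s hs => hu ⟨hs.1, hs.2.trans_lt (lt_min_iff.1 hv).1⟩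
  have hvr : v ≤ r := (lt_min_iff.1 hv).2.le
  obtain ⟨t, ht, hgt, hneg⟩ := exists_first_zero (f := fun s => -g s)
    (hg.neg.mono (Icc_subset_Ioo hav hr.2)) (neg_lt_zero.2 (hgv v ⟨hav, le_rfl⟩))
    ⟨r, right_mem_Icc.2 hvr, neg_nonneg.2 hgr⟩
  have htab : t ∈ Ioo a b := ⟨hav.trans ht.1, ht.2.trans_lt hr.2⟩
  have hle := hgap t htab fun s hs => (le_or_gt s v).elim (fun h => hgv s ⟨hs.1, h⟩)
    fun h => neg_lt_zero.1 (hneg s ⟨h.le, hs.2⟩)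
  have hδt : δ ≤ g t := by
    refine ge_of_tendsto ((hg.continuousAt (Ioo_mem_nhds htab.1 htab.2)).mono_left
      nhdsWithin_le_nhds : Tendsto g (𝓝[<] t) (𝓝 (g t))) ?_
    filter_upwards [Ioo_mem_nhdsLT htab.1] with s hs using hle s hs
  linarith

end Calculus

section SingularCauchy

/-- The moment `∫₀¹ tᵏ q(t r) dt`, that is `r⁻⁽ᵏ⁺¹⁾ ∫₀ʳ sᵏ q(s) ds` continued to the center. -/
def radialAverage (k : ℕ) (q : ℝ → ℝ) (r : ℝ) : ℝ := ∫ t in (0 : ℝ)..1, t ^ k * q (t * r)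

variable {k : ℕ} {q p : ℝ → ℝ}

lemma continuous_radialAverage (k : ℕ) (hq : Continuous q) : Continuous (radialAverage k q) :=
  intervalIntegral.continuous_parametric_intervalIntegral_of_continuous
    (by fun_prop) continuous_const

lemma radialAverage_const (k : ℕ) (m r : ℝ) : radialAverage k (fun _ => m) r = m / (k + 1) := by
  simp only [radialAverage, intervalIntegral.integral_mul_const, integral_pow, one_pow, ne_eq,
    Nat.add_eq_zero_iff, one_ne_zero, and_false, not_false_eq_true, zero_pow, sub_zero, one_div]
  ring

lemma pow_mul_radialAverage (k : ℕ) (q : ℝ → ℝ) (r : ℝ) :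
    r ^ (k + 1) * radialAverage k q r = ∫ s in (0 : ℝ)..r, s ^ k * q s := by
  have h := intervalIntegral.mul_integral_comp_mul_right (f := fun s => s ^ k * q s)
    (a := 0) (b := 1) r
  rw [zero_mul, one_mul] at h
  simp only [radialAverage, ← h, mul_pow, mul_right_comm _ (r ^ k),
    intervalIntegral.integral_mul_const]
  ring

lemma hasDerivAt_mul_radialAverage (k : ℕ) (hq : Continuous q) (r : ℝ) :
    HasDerivAt (fun s => s * radialAverage k q s) (q r - k * radialAverage k q r) r := by
  rcases eq_or_ne r 0 with rfl | hr
  · have hk : (k : ℝ) + 1 ≠ 0 := by positivity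
    have hcenter : radialAverage k q 0 = q 0 / (k + 1) := by
      simpa [radialAverage] using radialAverage_const k (q 0) 0
    rw [hasDerivAt_iff_tendsto_slope]
    have hlim := ((continuous_radialAverage k hq).tendsto 0).mono_left
      (nhdsWithin_le_nhds (s := {0}ᶜ))
    rw [show q 0 - k * radialAverage k q 0 = radialAverage k q 0 by rw [hcenter]; field_simp; ring]
    refine hlim.congr' ?_
    filter_upwards [self_mem_nhdsWithin] with s hs
    have hs : s ≠ 0 := hs
    rw [slope_def_field]
    field_simp
    ring
  · have hd : HasDerivAt (fun s => s ^ (k + 1) * radialAverage k q s) (r ^ k * q r) r := by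
      simp only [pow_mul_radialAverage]
      exact (Continuous.integral_hasStrictDerivAt (by fun_prop) 0 r).hasDerivAt
    refine ((hd.div (hasDerivAt_pow k r) (pow_ne_zero k hr)).congr_deriv
      ?_).congr_of_eventuallyEq ?_
    · rcases k with _ | k
      · simp
      · push_cast
        field_simp
        ring
    · filter_upwards [eventually_ne_nhds hr] with s hs
      simp only [Pi.div_apply]
      field_simp
      ring

lemma radialAverage_mono {r : ℝ} (hr : 0 ≤ r) (hp : Continuous p) (hq : Continuous q)
    (h : ∀ s ∈ Icc 0 r, p s ≤ q s) : radialAverage k p r ≤ radialAverage k q r := by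
  refine intervalIntegral.integral_mono_on zero_le_one
    (Continuous.intervalIntegrable (by fun_prop) _ _)
    (Continuous.intervalIntegrable (by fun_prop) _ _) fun t ht => ?_
  exact mul_le_mul_of_nonneg_left (h _ ⟨mul_nonneg ht.1 hr, mul_le_of_le_one_left hr ht.2⟩)
    (pow_nonneg ht.1 k)

lemma mul_abs_radialAverage_sub_le {r : ℝ} (hr : 0 ≤ r) (hp : Continuous p) (hq : Continuous q) :
    |r * radialAverage k p r - r * radialAverage k q r| ≤ ∫ s in (0 : ℝ)..r, |p s - q s| := by
  have hscale := intervalIntegral.mul_integral_comp_mul_right (f := fun s => |p s - q s|)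
    (a := 0) (b := 1) r
  rw [zero_mul, one_mul] at hscale
  rw [← mul_sub, abs_mul, abs_of_nonneg hr, ← hscale]
  refine mul_le_mul_of_nonneg_left ?_ hr
  rw [radialAverage, radialAverage, ← intervalIntegral.integral_sub
    (Continuous.intervalIntegrable (by fun_prop) _ _)
    (Continuous.intervalIntegrable (by fun_prop) _ _), ← Real.norm_eq_abs]
  refine intervalIntegral.norm_integral_le_of_norm_le zero_le_one
    (Eventually.of_forall fun t ht => ?_) (Continuous.intervalIntegrable (by fun_prop) _ _)
  rw [← mul_sub, Real.norm_eq_abs, abs_mul, abs_of_nonneg (pow_nonneg ht.1.le k)]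
  exact mul_le_of_le_one_left (abs_nonneg _) (pow_le_one₀ ht.1.le ht.2)

/-- A self-map of `C([0, Z], E)` with a Volterra type Lipschitz bound. -/
def IsVolterraLipschitz {E : Type*} [NormedAddCommGroup E] {Z : ℝ} (hZ : 0 ≤ Z) (Λ : ℝ)
    (T : C(Icc 0 Z, E) → C(Icc 0 Z, E)) : Prop :=
  ∀ x y (r : Icc 0 Z), ‖T x r - T y r‖ ≤
    Λ * ∫ s in (0 : ℝ)..r, ‖IccExtend hZ x s - IccExtend hZ y s‖

lemma IsVolterraLipschitz.norm_iterate_sub_le {E : Type*} [NormedAddCommGroup E] {Z Λ : ℝ}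
    {hZ : 0 ≤ Z} {T : C(Icc 0 Z, E) → C(Icc 0 Z, E)} (hT : IsVolterraLipschitz hZ Λ T)
    (hΛ : 0 ≤ Λ) (x y : C(Icc 0 Z, E)) (n : ℕ) (r : Icc 0 Z) :
    ‖T^[n] x r - T^[n] y r‖ ≤ (Λ * r) ^ n / n.factorial * dist x y := by
  induction n generalizing r with
  | zero => simpa [dist_eq_norm] using ContinuousMap.dist_apply_le_dist (f := x) (g := y) r
  | succ n ih =>
    rw [Function.iterate_succ_apply', Function.iterate_succ_apply']
    have hint : ∫ s in (0 : ℝ)..r, ‖IccExtend hZ (T^[n] x) s - IccExtend hZ (T^[n] y) s‖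
        ≤ ∫ s in (0 : ℝ)..r, Λ ^ n / n.factorial * dist x y * s ^ n := by
      refine intervalIntegral.integral_mono_on r.2.1
        (Continuous.intervalIntegrable (by fun_prop) _ _)
        (Continuous.intervalIntegrable (by fun_prop) _ _) fun s hs => ?_
      have hs' : s ∈ Icc 0 Z := ⟨hs.1, hs.2.trans r.2.2⟩
      rw [IccExtend_of_mem _ _ hs', IccExtend_of_mem _ _ hs']
      exact (ih ⟨s, hs'⟩).trans_eq (by rw [mul_pow]; ring)
    calc ‖T (T^[n] x) r - T (T^[n] y) r‖
        ≤ Λ * ∫ s in (0 : ℝ)..r, Λ ^ n / n.factorial * dist x y * s ^ n :=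
          (hT _ _ r).trans (mul_le_mul_of_nonneg_left hint hΛ)
      _ = (Λ * r) ^ (n + 1) / (n + 1).factorial * dist x y := by
          rw [intervalIntegral.integral_const_mul, integral_pow, Nat.factorial_succ,
            zero_pow n.succ_ne_zero]
          push_cast
          field_simp
          ring

lemma IsVolterraLipschitz.exists_fixedPoint {E : Type*} [NormedAddCommGroup E] [CompleteSpace E]
    {Z Λ : ℝ} {hZ : 0 ≤ Z} {T : C(Icc 0 Z, E) → C(Icc 0 Z, E)} (hT : IsVolterraLipschitz hZ Λ T)
    (hΛ : 0 ≤ Λ) : ∃ x, T x = x := by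
  obtain ⟨n, hn⟩ := ((FloorSemiring.tendsto_pow_div_factorial_atTop (Λ * Z)).eventually
    (gt_mem_nhds one_half_pos)).exists
  have hcontract : ContractingWith (1 / 2) T^[n] := by
    refine ⟨by rw [← NNReal.coe_lt_coe]; norm_num, LipschitzWith.of_dist_le_mul fun x y => ?_⟩
    refine (ContinuousMap.dist_le (by positivity)).2 fun r => ?_
    rw [dist_eq_norm]
    refine (hT.norm_iterate_sub_le hΛ x y n r).trans (mul_le_mul_of_nonneg_right ?_ dist_nonneg)
    calc (Λ * r) ^ n / n.factorial ≤ (Λ * Z) ^ n / n.factorial := by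
          have := r.2.1
          have := r.2.2
          gcongr
      _ ≤ ((1 / 2 : NNReal) : ℝ) := by simpa using hn.le
  have : Nonempty C(Icc 0 Z, E) := ⟨0⟩
  exact ⟨_, hcontract.isFixedPt_fixedPoint_iterate⟩

variable {ι : Type*} {κ : ι → ℕ} {x₀ : ι → ℝ}

/-- The solution of `xᵢ' = qᵢ - κᵢ (xᵢ - x₀ᵢ) / r` with `x(0) = x₀`. -/
def singularPrimitive (κ : ι → ℕ) (x₀ : ι → ℝ) (q : ℝ → ι → ℝ) (r : ℝ) : ι → ℝ :=
  fun i => x₀ i + r * radialAverage (κ i) (fun s => q s i) r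

lemma continuous_singularPrimitive (κ : ι → ℕ) (x₀ : ι → ℝ) {q : ℝ → ι → ℝ} (hq : Continuous q) :
    Continuous (singularPrimitive κ x₀ q) :=
  continuous_pi fun i => continuous_const.add
    (continuous_id.mul (continuous_radialAverage _ ((continuous_apply i).comp hq)))

variable [Fintype ι]

lemma norm_singularPrimitive_sub_le {p q : ℝ → ι → ℝ} {r : ℝ} (hr : 0 ≤ r) (hp : Continuous p)
    (hq : Continuous q) : ‖singularPrimitive κ x₀ p r - singularPrimitive κ x₀ q r‖ ≤
      ∫ s in (0 : ℝ)..r, ‖p s - q s‖ := by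
  refine (pi_norm_le_iff_of_nonneg
    (intervalIntegral.integral_nonneg hr fun _ _ => norm_nonneg _)).2 fun i => ?_
  rw [Pi.sub_apply, singularPrimitive, singularPrimitive, add_sub_add_left_eq_sub, Real.norm_eq_abs]
  refine (mul_abs_radialAverage_sub_le hr (by fun_prop) (by fun_prop)).trans ?_
  exact intervalIntegral.integral_mono_on hr (Continuous.intervalIntegrable (by fun_prop) _ _)
    (Continuous.intervalIntegrable (by fun_prop) _ _) fun s _ => norm_le_pi_norm (p s - q s) i

theorem exists_eq_comp_singularPrimitive (κ : ι → ℕ) (x₀ : ι → ℝ) {F : ℝ → (ι → ℝ) → ι → ℝ}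
    {Λ : NNReal} {Z : ℝ} (hZ : 0 ≤ Z) (hF : Continuous (Function.uncurry F))
    (hLip : ∀ r, LipschitzWith Λ (F r)) :
    ∃ q : ℝ → ι → ℝ, Continuous q ∧ ∀ r ∈ Icc 0 Z, q r = F r (singularPrimitive κ x₀ q r) := by
  have hcont : ∀ q : C(Icc 0 Z, ι → ℝ), Continuous (IccExtend hZ q) :=
    fun q => q.continuous.Icc_extend'
  let T : C(Icc 0 Z, ι → ℝ) → C(Icc 0 Z, ι → ℝ) := fun q =>
    ⟨fun r => F r (singularPrimitive κ x₀ (IccExtend hZ q) r), hF.comp <|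
      continuous_subtype_val.prodMk <|
        (continuous_singularPrimitive κ x₀ (hcont q)).comp continuous_subtype_val⟩
  have hT : IsVolterraLipschitz hZ Λ T := fun p q r => by
    refine ((hLip r).norm_sub_le _ _).trans (mul_le_mul_of_nonneg_left ?_ Λ.coe_nonneg)
    exact norm_singularPrimitive_sub_le r.2.1 (hcont p) (hcont q)
  obtain ⟨q, hq⟩ := hT.exists_fixedPoint Λ.coe_nonneg
  refine ⟨IccExtend hZ q, hcont q, fun r hr => ?_⟩
  calc IccExtend hZ q r = T q ⟨r, hr⟩ := by rw [IccExtend_of_mem _ _ hr, hq]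
    _ = F r (singularPrimitive κ x₀ (IccExtend hZ q) r) := rfl

/-- Solutions on `(0, R)` of the Cauchy problem `xᵢ' = Fᵢ(r, x) - κᵢ (xᵢ - x₀ᵢ) / r`, `x(0) = x₀`,
which is singular at the center. -/
structure IsSingularCauchySolution (κ : ι → ℕ) (x₀ : ι → ℝ) (F : ℝ → (ι → ℝ) → ι → ℝ) (R : ℝ)
    (x : ℝ → ι → ℝ) : Prop where
  hasDerivAt : ∀ r ∈ Ioo 0 R, ∀ i,
    HasDerivAt (fun s => x s i) (F r (x r) i - κ i / r * (x r i - x₀ i)) r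
  tendsto : Tendsto x (𝓝[>] 0) (𝓝 x₀)

lemma two_mul_apply_mul_sub_le {d e : ι → ℝ} {Λ c : ℝ} (hΛ : 0 ≤ Λ) (he : ‖e‖ ≤ Λ * ‖d‖)
    (hc : 0 ≤ c) (i : ι) : 2 * d i * (e i - c * d i) ≤ 2 * Λ * ∑ j, d j ^ 2 := by
  set D := ∑ j, d j ^ 2
  have hcoord : ∀ j, |d j| ≤ √D := fun j => Real.abs_le_sqrt
    (Finset.single_le_sum (f := fun j => d j ^ 2) (fun _ _ => sq_nonneg _) (Finset.mem_univ j))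
  have hnorm : ‖d‖ ≤ √D := (pi_norm_le_iff_of_nonneg D.sqrt_nonneg).2 hcoord
  have hei : |e i| ≤ Λ * √D :=
    (norm_le_pi_norm e i).trans (he.trans (mul_le_mul_of_nonneg_left hnorm hΛ))
  have hprod : d i * e i ≤ Λ * D :=
    calc d i * e i ≤ |d i| * |e i| := (le_abs_self _).trans_eq (abs_mul _ _)
      _ ≤ √D * (Λ * √D) := by gcongr; exact hcoord i
      _ = Λ * D := by rw [mul_left_comm, Real.mul_self_sqrt (by positivity)]
  nlinarith [mul_nonneg hc (sq_nonneg (d i))]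

/-- The singular terms only help: they contribute `-2 κᵢ (xᵢ - yᵢ)² / r` to the derivative of
`∑ (xᵢ - yᵢ)²`. -/
theorem IsSingularCauchySolution.eq_of_lipschitzOnWith {F : ℝ → (ι → ℝ) → ι → ℝ} {R : ℝ}
    {x y : ℝ → ι → ℝ} {Λ : NNReal} {S : ℝ → Set (ι → ℝ)}
    (hx : IsSingularCauchySolution κ x₀ F R x) (hy : IsSingularCauchySolution κ x₀ F R y)
    (hLip : ∀ r ∈ Ioo 0 R, LipschitzOnWith Λ (F r) (S r))
    (hxS : ∀ r ∈ Ioo 0 R, x r ∈ S r) (hyS : ∀ r ∈ Ioo 0 R, y r ∈ S r) :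
    EqOn x y (Ioo 0 R) := by
  have hd : ∀ r ∈ Ioo 0 R, ∀ i, HasDerivAt (fun s => (x s i - y s i) ^ 2)
      (2 * (x r i - y r i) * (F r (x r) i - F r (y r) i - κ i / r * (x r i - y r i))) r :=
    fun r hr i => (((hx.hasDerivAt r hr i).sub (hy.hasDerivAt r hr i)).pow 2).congr_deriv <| by
      simp only [Pi.sub_apply]
      ring
  have hle : ∀ r ∈ Ioo 0 R, ∀ i,
      2 * (x r i - y r i) * (F r (x r) i - F r (y r) i - κ i / r * (x r i - y r i)) ≤
        2 * Λ * ∑ j, (x r j - y r j) ^ 2 := fun r hr i =>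
    two_mul_apply_mul_sub_le Λ.coe_nonneg ((hLip r hr).norm_sub_le (hxS r hr) (hyS r hr))
      (div_nonneg (κ i).cast_nonneg hr.1.le) i
  have henergy := nonpos_of_deriv_le_mul (f := fun r => ∑ i, (x r i - y r i) ^ 2)
    (k := Fintype.card ι * (2 * Λ))
    (fun r hr => HasDerivAt.fun_sum fun i _ => hd r hr i)
    (fun r hr => (Finset.sum_le_card_nsmul _ _ _ fun i _ => hle r hr i).trans_eq <| by
      rw [nsmul_eq_mul, Finset.card_univ]
      ring)
    (by
      have h := tendsto_finsetSum Finset.univ fun i _ =>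
        ((tendsto_pi_nhds.1 hx.tendsto i).sub (tendsto_pi_nhds.1 hy.tendsto i)).pow 2
      simpa using h)
  intro r hr
  funext i
  have hzero := (Finset.sum_eq_zero_iff_of_nonneg fun j _ => sq_nonneg (x r j - y r j)).1
    ((henergy r hr).antisymm (Finset.sum_nonneg fun j _ => sq_nonneg _)) i (Finset.mem_univ i)
  exact sub_eq_zero.1 (pow_eq_zero_iff two_ne_zero |>.1 hzero)

end SingularCauchy

section Stretches

/-- Radial second Piola-Kirchhoff stress at the radial and tangential stretches `a, b`. -/
def piolaRad (lam mu a b : ℝ) : ℝ :=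
  ((lam + 2 * mu) * a ^ 2 + 2 * lam * b ^ 2 - (3 * lam + 2 * mu)) / 2

/-- Tangential second Piola-Kirchhoff stress at the radial and tangential stretches `a, b`. -/
def piolaTan (lam mu a b : ℝ) : ℝ :=
  (lam * a ^ 2 + 2 * (lam + mu) * b ^ 2 - (3 * lam + 2 * mu)) / 2

/-- Radial pressure at the stretches `a, b`: the radial Cauchy stress with the opposite sign. -/
def stretchRad (lam mu a b : ℝ) : ℝ := -(a / b ^ 2 * piolaRad lam mu a b)

/-- Tangential pressure at the stretches `a, b`: the tangential Cauchy stress with the opposite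
sign. -/
def stretchTan (lam mu a b : ℝ) : ℝ := -(piolaTan lam mu a b / a)

/-- The second derivative of the stored energy in the radial stretch; its sign decides
hyperbolicity. -/
def radModulus (lam mu a b : ℝ) : ℝ := piolaRad lam mu a b + (lam + 2 * mu) * a ^ 2

/-- The Saint Venant-Kirchhoff energy `λ (tr E)² / 2 + μ tr E²` of the strain `E` with eigenvalues
`(a² - 1) / 2, (b² - 1) / 2, (b² - 1) / 2`. -/
def stretchEnergy (lam mu a b : ℝ) : ℝ :=
  lam / 2 * ((a ^ 2 - 1) / 2 + 2 * ((b ^ 2 - 1) / 2)) ^ 2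
    + mu * (((a ^ 2 - 1) / 2) ^ 2 + 2 * ((b ^ 2 - 1) / 2) ^ 2)

/-- The tangential stretch of a state with relative mean density `e`. -/
def tanStretch (e : ℝ) : ℝ := e ^ (-(1 / 3) : ℝ)

/-- The radial stretch `a` of a state with relative density `d = 1 / (a b²)` and relative mean
density `e = 1 / b³`. -/
def radStretch (d e : ℝ) : ℝ := e * tanStretch e / d

variable {d e : ℝ}

lemma tanStretch_pos (he : 0 < e) : 0 < tanStretch e := Real.rpow_pos_of_pos he _

lemma radStretch_pos (hd : 0 < d) (he : 0 < e) : 0 < radStretch d e :=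
  div_pos (mul_pos he (tanStretch_pos he)) hd

lemma one_div_tanStretch_pow_three (he : 0 < e) : 1 / tanStretch e ^ 3 = e := by
  rw [tanStretch, ← Real.rpow_natCast, ← Real.rpow_mul he.le]
  norm_num [Real.rpow_neg_one]

lemma one_div_radStretch_mul (d : ℝ) (he : 0 < e) :
    1 / (radStretch d e * tanStretch e ^ 2) = d := by
  have hb := tanStretch_pos he
  have hcube : e * tanStretch e ^ 3 = 1 := by
    nth_rw 1 [← one_div_tanStretch_pow_three he]
    field_simp
  rw [radStretch, div_mul_eq_mul_div, one_div_div, mul_assoc, ← pow_succ', hcube, div_one]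

lemma tanStretch_one_div_pow_three {b : ℝ} (hb : 0 < b) : tanStretch (1 / b ^ 3) = b := by
  rw [tanStretch, one_div, Real.inv_rpow (by positivity), Real.rpow_neg (by positivity), inv_inv,
    one_div]
  exact Real.pow_rpow_inv_natCast hb.le three_ne_zero

lemma radStretch_one_div {a b : ℝ} (ha : 0 < a) (hb : 0 < b) :
    radStretch (1 / (a * b ^ 2)) (1 / b ^ 3) = a := by
  rw [radStretch, tanStretch_one_div_pow_three hb]
  field_simp

lemma div_tanStretch_pow_three {K rhoc : ℝ} (hK : 0 < K) (hrhoc : 0 < rhoc) :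
    K / tanStretch (rhoc / K) ^ 3 = rhoc := by
  rw [div_eq_mul_one_div, one_div_tanStretch_pow_three (div_pos hrhoc hK),
    mul_div_cancel₀ _ hK.ne']

lemma radStretch_self (hd : 0 < d) : radStretch d d = tanStretch d := by
  rw [radStretch, mul_div_cancel_left₀ _ hd.ne']

lemma tanStretch_lt_one_iff (hd : 0 < d) : tanStretch d < 1 ↔ 1 < d := by
  rw [tanStretch, Real.rpow_lt_one_iff_of_pos hd]
  constructor
  · rintro (h | h)
    · exact h.1
    · linarith [h.2]
  · exact fun h => Or.inl ⟨h, by norm_num⟩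

lemma hasDerivAt_radStretch_left (e : ℝ) (hd : 0 < d) :
    HasDerivAt (fun s => radStretch s e) (-(radStretch d e / d)) d := by
  refine ((hasDerivAt_inv hd.ne').const_mul (e * tanStretch e)).congr_deriv ?_
  rw [radStretch]
  field_simp

lemma hasDerivAt_tanStretch (he : 0 < e) :
    HasDerivAt tanStretch (-(tanStretch e / (3 * e))) e := by
  refine (Real.hasDerivAt_rpow_const (p := (-(1 / 3) : ℝ)) (Or.inl he.ne')).congr_deriv ?_
  rw [Real.rpow_sub_one he.ne', tanStretch]
  field_simp

lemma hasDerivAt_radStretch_right (d : ℝ) (he : 0 < e) :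
    HasDerivAt (fun t => radStretch d t) (2 / 3 * radStretch d e / e) e := by
  refine (((hasDerivAt_id e).mul (hasDerivAt_tanStretch he)).div_const d).congr_deriv ?_
  simp only [radStretch, id]
  field_simp
  ring

lemma contDiffOn_tanStretch :
    ContDiffOn ℝ 1 (fun q : ℝ × ℝ => tanStretch q.2) (Ioi 0 ×ˢ Ioi 0) :=
  contDiff_snd.contDiffOn.rpow_const_of_ne fun _ hq => ne_of_gt hq.2

lemma contDiffOn_radStretch :
    ContDiffOn ℝ 1 (fun q : ℝ × ℝ => radStretch q.1 q.2) (Ioi 0 ×ˢ Ioi 0) :=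
  (contDiff_snd.contDiffOn.mul contDiffOn_tanStretch).div contDiff_fst.contDiffOn
    fun _ hq => ne_of_gt hq.1

end Stretches

section ConstitutiveFunctions

variable (lam mu : ℝ) {d e : ℝ}

lemma svkEnergy_eq (hd : 0 < d) (he : 0 < e) :
    svkEnergy lam mu d e = stretchEnergy lam mu (radStretch d e) (tanStretch e) := by
  have hx : 0 < e ^ (1 / 3 : ℝ) := Real.rpow_pos_of_pos he _
  rw [svkEnergy, svkW, stretchEnergy, radStretch, tanStretch, Real.rpow_neg he.le]
  generalize e ^ (1 / 3 : ℝ) = x at *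
  simp only [zpow_neg, zpow_ofNat]
  field_simp
  ring

section Curves

variable {a b : ℝ → ℝ} {a' b' x : ℝ}

lemma hasDerivAt_stretchEnergy (ha : HasDerivAt a a' x) (hb : HasDerivAt b b' x) :
    HasDerivAt (fun s => stretchEnergy lam mu (a s) (b s))
      (a x * piolaRad lam mu (a x) (b x) * a' + 2 * b x * piolaTan lam mu (a x) (b x) * b') x := by
  have hEa := ((ha.pow 2).sub_const 1).div_const 2
  have hEb := ((hb.pow 2).sub_const 1).div_const 2
  refine ((((hEa.add (hEb.const_mul 2)).pow 2).const_mul (lam / 2)).add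
    (((hEa.pow 2).add ((hEb.pow 2).const_mul 2)).const_mul mu)).congr_deriv ?_
  simp only [piolaRad, piolaTan, Pi.add_apply, Pi.pow_apply]
  push_cast
  ring

lemma hasDerivAt_stretchRad (ha : HasDerivAt a a' x) (hb : HasDerivAt b b' x) (h0 : b x ≠ 0) :
    HasDerivAt (fun s => stretchRad lam mu (a s) (b s))
      (-(radModulus lam mu (a x) (b x) / b x ^ 2) * a'
        + a x / b x ^ 3 * ((lam + 2 * mu) * a x ^ 2 - (3 * lam + 2 * mu)) * b') x := by
  have hS := ((((ha.pow 2).const_mul (lam + 2 * mu)).add ((hb.pow 2).const_mul (2 * lam))).sub_const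
    (3 * lam + 2 * mu)).div_const 2
  refine ((ha.div (hb.pow 2) (pow_ne_zero 2 h0)).mul hS).neg.congr_deriv ?_
  simp only [radModulus, piolaRad, Pi.add_apply, Pi.pow_apply, Pi.div_apply]
  push_cast
  field_simp
  ring

end Curves

lemma svkRad_eq (hd : 0 < d) (he : 0 < e) :
    svkRad lam mu d e = stretchRad lam mu (radStretch d e) (tanStretch e) := by
  have hderiv := (hasDerivAt_stretchEnergy lam mu (hasDerivAt_radStretch_left e hd)
    (hasDerivAt_const d (tanStretch e))).congr_of_eventuallyEq
      ((lt_mem_nhds hd).mono fun s hs => svkEnergy_eq lam mu hs he)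
  have ha := radStretch_pos hd he
  have hb := tanStretch_pos he
  rw [svkRad, hyperRad, hderiv.deriv, stretchRad]
  nth_rw 1 5 [← one_div_radStretch_mul d he]
  field_simp
  ring

lemma svkTan_eq (hd : 0 < d) (he : 0 < e) :
    svkTan lam mu d e = stretchTan lam mu (radStretch d e) (tanStretch e) := by
  have hderiv := (hasDerivAt_stretchEnergy lam mu (hasDerivAt_radStretch_right d he)
    (hasDerivAt_tanStretch he)).congr_of_eventuallyEq
      ((lt_mem_nhds he).mono fun s hs => svkEnergy_eq lam mu hd hs)
  have ha := radStretch_pos hd he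
  have hb := tanStretch_pos he
  rw [svkTan, hyperTan, ← svkRad, svkRad_eq lam mu hd he, hderiv.deriv, stretchRad, stretchTan]
  have hd' := one_div_radStretch_mul d he
  generalize radStretch d e = a at *
  generalize tanStretch e = b at *
  subst hd'
  field_simp
  ring

variable {E : Type*} [NormedAddCommGroup E] [NormedSpace ℝ E] {s : Set E} {a b : E → ℝ}

lemma contDiffOn_stretchRad_comp (ha : ContDiffOn ℝ 1 a s) (hb : ContDiffOn ℝ 1 b s)
    (h0 : ∀ x ∈ s, b x ≠ 0) : ContDiffOn ℝ 1 (fun x => stretchRad lam mu (a x) (b x)) s :=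
  ((ha.div (hb.pow 2) fun x hx => pow_ne_zero 2 (h0 x hx)).mul
    ((((contDiffOn_const.mul (ha.pow 2)).add (contDiffOn_const.mul (hb.pow 2))).sub
      contDiffOn_const).div_const 2)).neg

lemma contDiffOn_stretchTan_comp (ha : ContDiffOn ℝ 1 a s) (hb : ContDiffOn ℝ 1 b s)
    (h0 : ∀ x ∈ s, a x ≠ 0) : ContDiffOn ℝ 1 (fun x => stretchTan lam mu (a x) (b x)) s :=
  (((((contDiffOn_const.mul (ha.pow 2)).add (contDiffOn_const.mul (hb.pow 2))).sub
    contDiffOn_const).div_const 2).div ha h0).neg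

lemma contDiffOn_stretchRad :
    ContDiffOn ℝ 1 (fun q : ℝ × ℝ => stretchRad lam mu q.1 q.2) (Ioi 0 ×ˢ Ioi 0) :=
  contDiffOn_stretchRad_comp lam mu contDiffOn_fst contDiffOn_snd fun _ hq => (mem_Ioi.1 hq.2).ne'

lemma contDiffOn_stretchTan :
    ContDiffOn ℝ 1 (fun q : ℝ × ℝ => stretchTan lam mu q.1 q.2) (Ioi 0 ×ˢ Ioi 0) :=
  contDiffOn_stretchTan_comp lam mu contDiffOn_fst contDiffOn_snd fun _ hq => (mem_Ioi.1 hq.1).ne'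

lemma contDiffOn_svkRad :
    ContDiffOn ℝ 1 (fun q : ℝ × ℝ => svkRad lam mu q.1 q.2) (Ioi 0 ×ˢ Ioi 0) :=
  (contDiffOn_stretchRad_comp lam mu contDiffOn_radStretch contDiffOn_tanStretch
    fun _ hq => (tanStretch_pos hq.2).ne').congr fun _ hq => svkRad_eq lam mu hq.1 hq.2

lemma contDiffOn_svkTan :
    ContDiffOn ℝ 1 (fun q : ℝ × ℝ => svkTan lam mu q.1 q.2) (Ioi 0 ×ˢ Ioi 0) :=
  (contDiffOn_stretchTan_comp lam mu contDiffOn_radStretch contDiffOn_tanStretch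
    fun _ hq => (radStretch_pos hq.1 hq.2).ne').congr fun _ hq => svkTan_eq lam mu hq.1 hq.2

lemma strictlyHyperbolicAt_iff (hd : 0 < d) (he : 0 < e) :
    StrictlyHyperbolicAt (svkRad lam mu) d e ↔
      0 < radModulus lam mu (radStretch d e) (tanStretch e) := by
  have hb := tanStretch_pos he
  have ha := radStretch_pos hd he
  have hderiv := (hasDerivAt_stretchRad lam mu (hasDerivAt_radStretch_left e hd)
    (hasDerivAt_const d (tanStretch e)) hb.ne').congr_of_eventuallyEq
      ((lt_mem_nhds hd).mono fun s hs => svkRad_eq lam mu hs he)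
  rw [StrictlyHyperbolicAt, hderiv.deriv, mul_zero, add_zero, neg_mul_neg,
    mul_pos_iff_of_pos_right (by positivity), div_pos_iff_of_pos_right (by positivity)]

end ConstitutiveFunctions

/-- Nonnegative shear modulus and positive bulk modulus. -/
structure AdmissibleModuli (lam mu : ℝ) : Prop where
  shear_nonneg : 0 ≤ mu
  bulk_pos : 0 < 3 * lam + 2 * mu

section AdmissibleModuli

variable {lam mu a b : ℝ}

lemma AdmissibleModuli.pWave_pos (h : AdmissibleModuli lam mu) : 0 < lam + 2 * mu := by
  linarith [h.shear_nonneg, h.bulk_pos]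

lemma AdmissibleModuli.deltaFlat_num_pos (h : AdmissibleModuli lam mu) :
    0 < 5 * lam + 6 * mu := by
  linarith [h.shear_nonneg, h.bulk_pos]

lemma piolaTan_sub_piolaRad (lam mu a b : ℝ) :
    piolaTan lam mu a b - piolaRad lam mu a b = mu * (b ^ 2 - a ^ 2) := by
  rw [piolaTan, piolaRad]
  ring

lemma piolaRad_add_two_mul_piolaTan (lam mu a b : ℝ) :
    piolaRad lam mu a b + 2 * piolaTan lam mu a b =
      (3 * lam + 2 * mu) / 2 * (a ^ 2 + 2 * b ^ 2 - 3) := by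
  rw [piolaTan, piolaRad]
  ring

lemma piolaRad_self (lam mu b : ℝ) :
    piolaRad lam mu b b = (3 * lam + 2 * mu) / 2 * (b ^ 2 - 1) := by
  rw [piolaRad]
  ring

lemma stretchRad_self_eq_stretchTan (lam mu b : ℝ) :
    stretchRad lam mu b b = stretchTan lam mu b b := by
  rw [stretchRad, stretchTan, piolaRad, piolaTan]
  field_simp
  ring

lemma radModulus_self (lam mu b : ℝ) :
    radModulus lam mu b b = ((5 * lam + 6 * mu) * b ^ 2 - (3 * lam + 2 * mu)) / 2 := by
  rw [radModulus, piolaRad]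
  ring

lemma AdmissibleModuli.piolaTan_le_piolaRad (h : AdmissibleModuli lam mu) (hb : 0 ≤ b)
    (hab : b ≤ a) : piolaTan lam mu a b ≤ piolaRad lam mu a b := by
  have hsq : b ^ 2 ≤ a ^ 2 := pow_le_pow_left₀ hb hab 2
  nlinarith [piolaTan_sub_piolaRad lam mu a b, h.shear_nonneg]

lemma AdmissibleModuli.sq_add_two_mul_sq_lt_three (h : AdmissibleModuli lam mu)
    (hrad : piolaRad lam mu a b < 0) (htan : piolaTan lam mu a b < 0) : a ^ 2 + 2 * b ^ 2 < 3 := by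
  nlinarith [piolaRad_add_two_mul_piolaTan lam mu a b, h.bulk_pos]

lemma AdmissibleModuli.sq_add_two_mul_sq_le_three (h : AdmissibleModuli lam mu) (hb : 0 ≤ b)
    (hab : b ≤ a) (hrad : piolaRad lam mu a b ≤ 0) : a ^ 2 + 2 * b ^ 2 ≤ 3 := by
  nlinarith [piolaRad_add_two_mul_piolaTan lam mu a b, h.bulk_pos, h.piolaTan_le_piolaRad hb hab]

lemma AdmissibleModuli.radModulus_mono (h : AdmissibleModuli lam mu) {β : ℝ} (hβ : 0 ≤ β)
    (hb : β ≤ b) (hab : b ≤ a) : radModulus lam mu β β ≤ radModulus lam mu a b := by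
  have hdiff : radModulus lam mu a b - radModulus lam mu b b =
      3 / 2 * (lam + 2 * mu) * (a ^ 2 - b ^ 2) := by
    rw [radModulus, radModulus, piolaRad, piolaRad]
    ring
  have hbβ := pow_le_pow_left₀ hβ hb 2
  have hba := pow_le_pow_left₀ (hβ.trans hb) hab 2
  calc radModulus lam mu β β ≤ radModulus lam mu b b := by
        rw [radModulus_self, radModulus_self]
        nlinarith [h.deltaFlat_num_pos]
    _ ≤ radModulus lam mu a b := by nlinarith [h.pWave_pos]

theorem AdmissibleModuli.strictlyHyperbolicAt_self_iff (h : AdmissibleModuli lam mu) {d : ℝ}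
    (hd : 0 < d) : StrictlyHyperbolicAt (svkRad lam mu) d d ↔ d < deltaFlat lam mu := by
  have hsq : tanStretch d ^ 2 = (d ^ (2 / 3 : ℝ))⁻¹ := by
    rw [tanStretch, ← Real.rpow_natCast, ← Real.rpow_mul hd.le, ← Real.rpow_neg hd.le]
    norm_num
  have hpow : 0 < d ^ (2 / 3 : ℝ) := Real.rpow_pos_of_pos hd _
  rw [strictlyHyperbolicAt_iff lam mu hd hd, radStretch_self hd, radModulus_self, hsq, deltaFlat,
    show (3 / 2 : ℝ) = (2 / 3 : ℝ)⁻¹ by norm_num, Real.lt_rpow_inv_iff_of_pos hd.le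
      (div_nonneg h.deltaFlat_num_pos.le h.bulk_pos.le) (by norm_num),
    lt_div_iff₀ h.bulk_pos, div_pos_iff_of_pos_right two_pos, sub_pos, lt_mul_inv_iff₀ hpow,
    mul_comm]

end AdmissibleModuli

section StretchSystem

/-- The static equations for the radial and tangential stretches `a, b` at the radius `r`, where
`c = (4π/3) K²`: the definition of `η` and the balance of momentum. -/
structure SolvesStretchSystemAt (lam mu c : ℝ) (a b : ℝ → ℝ) (r : ℝ) : Prop where
  differentiableAt_rad : DifferentiableAt ℝ a r
  hasDerivAt_tan : HasDerivAt b (b r * (a r - b r) / (r * a r)) r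
  balance : HasDerivAt (fun s => stretchRad lam mu (a s) (b s))
    (-(2 / r) * (stretchRad lam mu (a r) (b r) - stretchTan lam mu (a r) (b r))
      - c * r / (a r * b r ^ 5)) r

/-- The anisotropy `w = (a - b) / r` of the stretches `a, b`. -/
def stretchGap (a b : ℝ → ℝ) (r : ℝ) : ℝ := (a r - b r) / r

/-- Right hand side of the equation `b' = tanField r w b`. -/
def tanField (r w b : ℝ) : ℝ := w * b / (b + r * w)

/-- Right hand side of the equation `w' = radField r w b - 4 w / r`. -/
def radField (lam mu c r w b : ℝ) : ℝ :=
  c / ((b + r * w) * b ^ 3 * radModulus lam mu (b + r * w) b)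
    + w ^ 2 * (3 / (b + r * w) + 2 * b * ((lam + 2 * mu) * (b + r * w) + mu * b)
        / ((b + r * w) * radModulus lam mu (b + r * w) b))

section Equivalence

variable {lam mu c r : ℝ} {a b : ℝ → ℝ}

lemma add_mul_stretchGap (a b : ℝ → ℝ) (hr : r ≠ 0) : b r + r * stretchGap a b r = a r := by
  rw [stretchGap, mul_div_cancel₀ _ hr, add_sub_cancel]

lemma tanField_stretchGap (hr : r ≠ 0) :
    tanField r (stretchGap a b r) (b r) = b r * (a r - b r) / (r * a r) := by
  rw [tanField, add_mul_stretchGap a b hr, stretchGap]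
  field_simp

lemma balance_sub_eq (hr : r ≠ 0) (ha : a r ≠ 0) (hb : b r ≠ 0)
    (hW : radModulus lam mu (a r) (b r) ≠ 0) (a' : ℝ) :
    -(radModulus lam mu (a r) (b r) / b r ^ 2) * a' + a r / b r ^ 3 *
        ((lam + 2 * mu) * a r ^ 2 - (3 * lam + 2 * mu)) * tanField r (stretchGap a b r) (b r) -
      (-(2 / r) * (stretchRad lam mu (a r) (b r) - stretchTan lam mu (a r) (b r))
        - c * r / (a r * b r ^ 5)) =
    radModulus lam mu (a r) (b r) / b r ^ 2 * (tanField r (stretchGap a b r) (b r)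
      + r * radField lam mu c r (stretchGap a b r) (b r) - 3 * stretchGap a b r - a') := by
  rw [tanField_stretchGap hr, radField, add_mul_stretchGap a b hr, stretchGap, stretchRad,
    stretchTan]
  generalize hWe : radModulus lam mu (a r) (b r) = W at *
  have hS : piolaRad lam mu (a r) (b r) = W - (lam + 2 * mu) * a r ^ 2 := by
    rw [← hWe, radModulus]
    ring
  have hT : piolaTan lam mu (a r) (b r) =
      W - (lam + 2 * mu) * a r ^ 2 + mu * (b r ^ 2 - a r ^ 2) := by
    rw [← hS, ← piolaTan_sub_piolaRad]
    ring
  have hB : 3 * lam + 2 * mu = 3 * (lam + 2 * mu) * a r ^ 2 + 2 * lam * b r ^ 2 - 2 * W := by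
    rw [← hWe, radModulus, piolaRad]
    ring
  rw [hS, hT, hB]
  field_simp
  ring

lemma solvesStretchSystemAt_iff (hr : r ≠ 0) (ha : a r ≠ 0) (hb : b r ≠ 0)
    (hW : radModulus lam mu (a r) (b r) ≠ 0) :
    SolvesStretchSystemAt lam mu c a b r ↔
      HasDerivAt b (tanField r (stretchGap a b r) (b r)) r ∧
      HasDerivAt a (tanField r (stretchGap a b r) (b r)
        + r * radField lam mu c r (stretchGap a b r) (b r) - 3 * stretchGap a b r) r := by
  constructor
  · intro h
    have hbd : HasDerivAt b (tanField r (stretchGap a b r) (b r)) r :=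
      tanField_stretchGap (a := a) (b := b) hr ▸ h.hasDerivAt_tan
    have had := h.differentiableAt_rad.hasDerivAt
    have hdiff := balance_sub_eq (c := c) hr ha hb hW (deriv a r)
    rw [(hasDerivAt_stretchRad lam mu had hbd hb).unique h.balance, sub_self, eq_comm,
      mul_eq_zero_iff_left (by positivity), sub_eq_zero] at hdiff
    exact ⟨hbd, hdiff ▸ had⟩
  · rintro ⟨hbd, had⟩
    refine ⟨had.differentiableAt, tanField_stretchGap (a := a) (b := b) hr ▸ hbd, ?_⟩
    refine (hasDerivAt_stretchRad lam mu had hbd hb).congr_deriv ?_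
    rw [← sub_eq_zero, balance_sub_eq hr ha hb hW, sub_self, mul_zero]

lemma SolvesStretchSystemAt.hasDerivAt_stretchGap (h : SolvesStretchSystemAt lam mu c a b r)
    (hr : r ≠ 0) (ha : a r ≠ 0) (hb : b r ≠ 0) (hW : radModulus lam mu (a r) (b r) ≠ 0) :
    HasDerivAt (stretchGap a b)
      (radField lam mu c r (stretchGap a b r) (b r) - 4 / r * stretchGap a b r) r := by
  obtain ⟨hbd, had⟩ := (solvesStretchSystemAt_iff hr ha hb hW).1 h
  refine ((had.sub hbd).div (hasDerivAt_id r) hr).congr_deriv ?_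
  rw [Pi.sub_apply, id, show a r - b r = r * stretchGap a b r by
    rw [stretchGap, mul_div_cancel₀ _ hr]]
  field_simp
  ring

end Equivalence

/-- A hyperbolic state of the center: both stretches equal `β`. -/
structure IsHyperbolicCenter (lam mu β : ℝ) : Prop where
  moduli : AdmissibleModuli lam mu
  stretch_pos : 0 < β
  radModulus_pos : 0 < radModulus lam mu β β

/-- A bound for the growth of the anisotropy: `w ≤ gapSlope * r` along solutions which start at the
center with the stretch `β`. -/
def gapSlope (lam mu c β : ℝ) : ℝ := c / (2 * β ^ 4 * radModulus lam mu β β)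

lemma IsHyperbolicCenter.of_lt_deltaFlat {lam mu d : ℝ} (hm : AdmissibleModuli lam mu)
    (hd : 0 < d) (hlt : d < deltaFlat lam mu) : IsHyperbolicCenter lam mu (tanStretch d) where
  moduli := hm
  stretch_pos := tanStretch_pos hd
  radModulus_pos := by
    have hhyp := (strictlyHyperbolicAt_iff lam mu hd hd).1
      ((hm.strictlyHyperbolicAt_self_iff hd).2 hlt)
    rwa [radStretch_self hd] at hhyp

section FieldBounds

variable {lam mu c β r w b : ℝ}

lemma radField_pos (h : AdmissibleModuli lam mu) (hc : 0 < c) (ha : 0 < b + r * w) (hb : 0 < b)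
    (hW : 0 < radModulus lam mu (b + r * w) b) : 0 < radField lam mu c r w b := by
  have := h.pWave_pos
  have := h.shear_nonneg
  rw [radField]
  positivity

lemma IsHyperbolicCenter.gapSlope_pos (hβ : IsHyperbolicCenter lam mu β) (hc : 0 < c) :
    0 < gapSlope lam mu c β := by
  have := hβ.stretch_pos
  have := hβ.radModulus_pos
  rw [gapSlope]
  positivity

lemma IsHyperbolicCenter.radModulus_pos_of_le (hβ : IsHyperbolicCenter lam mu β) {a b : ℝ}
    (hb : β ≤ b) (hab : b ≤ a) : 0 < radModulus lam mu a b :=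
  hβ.radModulus_pos.trans_le (hβ.moduli.radModulus_mono hβ.stretch_pos.le hb hab)

lemma IsHyperbolicCenter.mul_le_radModulus (hβ : IsHyperbolicCenter lam mu β) {a : ℝ}
    (hb : β ≤ b) (hab : b ≤ a) :
    2 * (a - b) * ((lam + 2 * mu) * a + mu * b) ≤ 3 * radModulus lam mu a b := by
  have hb0 : 0 < b := hβ.stretch_pos.trans_le hb
  have hW := hβ.radModulus_pos_of_le hb le_rfl
  have hL := hβ.moduli.pWave_pos
  have hmu : mu ≤ lam + 2 * mu := by linarith [hβ.moduli.shear_nonneg, hβ.moduli.bulk_pos]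
  have hdiff : radModulus lam mu a b =
      radModulus lam mu b b + 3 / 2 * (lam + 2 * mu) * (a - b) * (a + b) := by
    rw [radModulus, radModulus, piolaRad, piolaRad]
    ring
  have hprod : (a - b) * ((lam + 2 * mu) * a + mu * b) ≤ (lam + 2 * mu) * (a - b) * (a + b) :=
    calc (a - b) * ((lam + 2 * mu) * a + mu * b)
        ≤ (a - b) * ((lam + 2 * mu) * a + (lam + 2 * mu) * b) := by gcongr
      _ = (lam + 2 * mu) * (a - b) * (a + b) := by ring
  have hnonneg : 0 ≤ (lam + 2 * mu) * (a - b) * (a + b) :=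
    mul_nonneg (mul_nonneg hL.le (sub_nonneg.2 hab)) (by linarith)
  linarith

lemma IsHyperbolicCenter.radField_le (hβ : IsHyperbolicCenter lam mu β) (hc : 0 < c) {V : ℝ}
    (hr : 0 ≤ r) (hw : 0 ≤ w) (hb : β ≤ b) (hV : 0 ≤ V) (hwV : w ≤ V * r) :
    radField lam mu c r w b ≤ 2 * gapSlope lam mu c β + 3 * V := by
  have hβ0 := hβ.stretch_pos
  have hWβ0 := hβ.radModulus_pos
  have hb0 : 0 < b := hβ0.trans_le hb
  have hu : 0 ≤ r * w := mul_nonneg hr hw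
  have hab : b ≤ b + r * w := by linarith
  have : 0 < b + r * w := by linarith
  have hW := hβ.radModulus_pos_of_le hb hab
  have hWβ := hβ.moduli.radModulus_mono hβ0.le hb hab
  have hL := hβ.moduli.pWave_pos
  have hmu := hβ.moduli.shear_nonneg
  rw [radField]
  refine add_le_add ?_ ?_
  · calc c / ((b + r * w) * b ^ 3 * radModulus lam mu (b + r * w) b)
        ≤ c / (β * β ^ 3 * radModulus lam mu β β) := by gcongr; linarith
      _ = 2 * gapSlope lam mu c β := by rw [gapSlope]; field_simp
  · set Q := 3 / (b + r * w) + 2 * b * ((lam + 2 * mu) * (b + r * w) + mu * b)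
        / ((b + r * w) * radModulus lam mu (b + r * w) b) with hQ
    have : 0 ≤ Q := by positivity
    have hQ3 : r * w * Q ≤ 3 := by
      have hkey := hβ.mul_le_radModulus hb hab
      rw [add_sub_cancel_left] at hkey
      have hsplit : 3 - r * w * Q = b * (3 * radModulus lam mu (b + r * w) b
          - 2 * (r * w) * ((lam + 2 * mu) * (b + r * w) + mu * b)) /
            ((b + r * w) * radModulus lam mu (b + r * w) b) := by
        rw [hQ]
        field_simp
        ring
      have : 0 ≤ 3 - r * w * Q := hsplit ▸ div_nonneg
        (mul_nonneg hb0.le (sub_nonneg.2 hkey)) (by positivity)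
      linarith
    calc w ^ 2 * Q = w * (w * Q) := by ring
      _ ≤ V * r * (w * Q) := by gcongr
      _ = V * (r * w * Q) := by ring
      _ ≤ V * 3 := by gcongr
      _ = 3 * V := by ring

lemma IsHyperbolicCenter.le_radField (hβ : IsHyperbolicCenter lam mu β) (hc : 0 < c)
    (hr : 0 ≤ r) (hw : 0 ≤ w) (hb : β ≤ b) (hS : piolaRad lam mu (b + r * w) b ≤ 0) :
    c / (8 * (lam + 2 * mu)) ≤ radField lam mu c r w b := by
  have hb0 : 0 < b := hβ.stretch_pos.trans_le hb
  have hab : b ≤ b + r * w := le_add_of_nonneg_right (mul_nonneg hr hw)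
  have hW := hβ.radModulus_pos_of_le hb hab
  have hL := hβ.moduli.pWave_pos
  have hmu := hβ.moduli.shear_nonneg
  have hsq := hβ.moduli.sq_add_two_mul_sq_le_three hb0.le hab hS
  rw [radField]
  generalize b + r * w = a at *
  have ha0 : 0 < a := hb0.trans_le hab
  have ha2 : a ≤ 2 := by nlinarith
  have hb1 : b ^ 3 ≤ 1 := pow_le_one₀ hb0.le (by nlinarith)
  have hWL : radModulus lam mu a b ≤ (lam + 2 * mu) * a ^ 2 := by
    rw [radModulus]
    linarith
  calc c / (8 * (lam + 2 * mu)) = c / (2 * 1 * ((lam + 2 * mu) * 2 ^ 2)) := by ring_nf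
    _ ≤ c / (a * b ^ 3 * ((lam + 2 * mu) * a ^ 2)) := by gcongr
    _ ≤ c / (a * b ^ 3 * radModulus lam mu a b) := by gcongr
    _ ≤ _ := le_add_of_nonneg_right (by positivity)

end FieldBounds

end StretchSystem

section StretchField

variable {lam mu c β : ℝ}

/-- Right hand side of the stretch equations in the variables `x = ![w, b]`. -/
def stretchField (lam mu c r : ℝ) (x : Fin 2 → ℝ) : Fin 2 → ℝ :=
  ![radField lam mu c r (x 0) (x 1), tanField r (x 0) (x 1)]

/-- The states `![w, b]` with `0 ≤ w ≤ Y` and `β ≤ b ≤ 1`. -/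
def stretchBox (β Y : ℝ) : Set (Fin 2 → ℝ) := Icc ![0, β] ![Y, 1]

lemma mem_stretchBox {Y : ℝ} {x : Fin 2 → ℝ} :
    x ∈ stretchBox β Y ↔ (0 ≤ x 0 ∧ x 0 ≤ Y) ∧ β ≤ x 1 ∧ x 1 ≤ 1 := by
  simp only [stretchBox, mem_Icc, Pi.le_def, Fin.forall_fin_two]
  exact and_and_and_comm

lemma contDiffOn_tanField (hβ : 0 < β) (Z Y : ℝ) :
    ContDiffOn ℝ 1 (fun p : ℝ × (Fin 2 → ℝ) => tanField p.1 (p.2 0) (p.2 1))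
      (Icc 0 Z ×ˢ stretchBox β Y) := by
  unfold tanField
  refine ContDiffOn.div (by fun_prop) (by fun_prop) fun p hp => ?_
  have hx := mem_stretchBox.1 hp.2
  have hu : 0 ≤ p.1 * p.2 0 := mul_nonneg hp.1.1 hx.1.1
  linarith [hx.2.1]

lemma IsHyperbolicCenter.contDiffOn_radField (hβ : IsHyperbolicCenter lam mu β) (c Z Y : ℝ) :
    ContDiffOn ℝ 1 (fun p : ℝ × (Fin 2 → ℝ) => radField lam mu c p.1 (p.2 0) (p.2 1))
      (Icc 0 Z ×ˢ stretchBox β Y) := by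
  have hpos : ∀ p ∈ Icc 0 Z ×ˢ stretchBox β Y, 0 < p.2 1 ∧ 0 < p.2 1 + p.1 * p.2 0 ∧
      0 < radModulus lam mu (p.2 1 + p.1 * p.2 0) (p.2 1) := fun p hp => by
    have hx := mem_stretchBox.1 hp.2
    have hu : 0 ≤ p.1 * p.2 0 := mul_nonneg hp.1.1 hx.1.1
    have hb : 0 < p.2 1 := hβ.stretch_pos.trans_le hx.2.1
    exact ⟨hb, by linarith, hβ.radModulus_pos_of_le hx.2.1 (by linarith)⟩
  have hW : ContDiffOn ℝ 1 (fun p : ℝ × (Fin 2 → ℝ) =>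
      radModulus lam mu (p.2 1 + p.1 * p.2 0) (p.2 1)) (Icc 0 Z ×ˢ stretchBox β Y) := by
    unfold radModulus piolaRad
    fun_prop
  unfold radField
  refine ContDiffOn.add (ContDiffOn.div (by fun_prop) (by fun_prop) fun p hp => ?_)
    (ContDiffOn.mul (by fun_prop) (ContDiffOn.add
      (ContDiffOn.div (by fun_prop) (by fun_prop) fun p hp => ?_)
      (ContDiffOn.div (by fun_prop) (by fun_prop) fun p hp => ?_)))
  all_goals
    obtain ⟨hb, ha, hW⟩ := hpos p hp
    positivity

lemma IsHyperbolicCenter.contDiffOn_stretchField (hβ : IsHyperbolicCenter lam mu β) (c Z Y : ℝ) :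
    ContDiffOn ℝ 1 (fun p : ℝ × (Fin 2 → ℝ) => stretchField lam mu c p.1 p.2)
      (Icc 0 Z ×ˢ stretchBox β Y) :=
  contDiffOn_pi.2 <| Fin.forall_fin_two.2
    ⟨hβ.contDiffOn_radField c Z Y, contDiffOn_tanField hβ.stretch_pos Z Y⟩

lemma IsHyperbolicCenter.exists_lipschitzOnWith_stretchField (hβ : IsHyperbolicCenter lam mu β)
    (c Z Y : ℝ) : ∃ Λ, ∀ r ∈ Icc 0 Z,
      LipschitzOnWith Λ (stretchField lam mu c r) (stretchBox β Y) := by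
  obtain ⟨Λ, hΛ⟩ := (hβ.contDiffOn_stretchField c Z Y).exists_lipschitzOnWith one_ne_zero
    ((convex_Icc _ _).prod (convex_Icc _ _)) (isCompact_Icc.prod isCompact_Icc)
  refine ⟨Λ, fun r hr x hx y hy => ?_⟩
  simpa [Prod.edist_eq] using hΛ (mk_mem_prod hr hx) (mk_mem_prod hr hy)

end StretchField

/-- A solution of the stretch equations on `(0, R)` which starts at the center with the stretch `β`
and is radially compressed. -/
structure IsStretchProfile (lam mu c β : ℝ) (a b : ℝ → ℝ) (R : ℝ) : Prop where
  rad_pos : ∀ r ∈ Ioo 0 R, 0 < a r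
  tan_pos : ∀ r ∈ Ioo 0 R, 0 < b r
  solves : ∀ r ∈ Ioo 0 R, SolvesStretchSystemAt lam mu c a b r
  tendsto_rad : Tendsto a (𝓝[>] 0) (𝓝 β)
  tendsto_tan : Tendsto b (𝓝[>] 0) (𝓝 β)
  piolaRad_neg : ∀ r ∈ Ioo 0 R, piolaRad lam mu (a r) (b r) < 0

namespace IsStretchProfile

variable {lam mu c β R : ℝ} {a b : ℝ → ℝ}

lemma mono (h : IsStretchProfile lam mu c β a b R) {R' : ℝ} (hR : R' ≤ R) :
    IsStretchProfile lam mu c β a b R' where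
  rad_pos r hr := h.rad_pos r (Ioo_subset_Ioo_right hR hr)
  tan_pos r hr := h.tan_pos r (Ioo_subset_Ioo_right hR hr)
  solves r hr := h.solves r (Ioo_subset_Ioo_right hR hr)
  tendsto_rad := h.tendsto_rad
  tendsto_tan := h.tendsto_tan
  piolaRad_neg r hr := h.piolaRad_neg r (Ioo_subset_Ioo_right hR hr)

/-- The equation for the anisotropy reads `(r⁴ w)' = r⁴ radField`, and `radField` is positive. -/
lemma tan_lt_rad_of_radModulus_pos (h : IsStretchProfile lam mu c β a b R)
    (hm : AdmissibleModuli lam mu) (hc : 0 < c)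
    (hW : ∀ r ∈ Ioo 0 R, 0 < radModulus lam mu (a r) (b r)) : ∀ r ∈ Ioo 0 R, b r < a r := by
  have hderiv : ∀ r ∈ Ioo 0 R, HasDerivAt (fun s => s ^ 4 * stretchGap a b s)
      (r ^ 4 * radField lam mu c r (stretchGap a b r) (b r)) r := fun r hr => by
    have hgap := (h.solves r hr).hasDerivAt_stretchGap hr.1.ne' (h.rad_pos r hr).ne'
      (h.tan_pos r hr).ne' (hW r hr).ne'
    refine ((hasDerivAt_pow 4 r).mul hgap).congr_deriv ?_
    have := hr.1.ne'
    push_cast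
    field_simp
    ring
  have hfield : ∀ r ∈ Ioo 0 R, 0 < r ^ 4 * radField lam mu c r (stretchGap a b r) (b r) :=
    fun r hr => by
      have ha := add_mul_stretchGap a b hr.1.ne'
      exact mul_pos (pow_pos hr.1 4) (radField_pos hm hc (ha ▸ h.rad_pos r hr) (h.tan_pos r hr)
        (ha ▸ hW r hr))
  have hlim : Tendsto (fun s => s ^ 4 * stretchGap a b s) (𝓝[>] 0) (𝓝 0) := by
    have hprod : Tendsto (fun s => s ^ 3 * (a s - b s)) (𝓝[>] 0) (𝓝 (0 ^ 3 * (β - β))) :=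
      (tendsto_nhdsWithin_of_tendsto_nhds ((continuous_pow 3).tendsto 0)).mul
        (h.tendsto_rad.sub h.tendsto_tan)
    rw [sub_self, mul_zero] at hprod
    refine hprod.congr' ?_
    filter_upwards [self_mem_nhdsWithin] with s hs
    have := (mem_Ioi.1 hs).ne'
    rw [stretchGap]
    field_simp
  intro r hr
  have hgap := pos_of_mul_pos_right (lt_of_tendsto_nhdsGT_of_deriv_pos hderiv hfield hlim r hr)
    (pow_pos hr.1 4).le
  exact sub_pos.1 ((div_pos_iff_of_pos_right hr.1).1 hgap)

lemma lt_tan_of_tan_lt_rad (h : IsStretchProfile lam mu c β a b R)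
    (hab : ∀ r ∈ Ioo 0 R, b r < a r) : ∀ r ∈ Ioo 0 R, β < b r :=
  lt_of_tendsto_nhdsGT_of_deriv_pos (fun r hr => (h.solves r hr).hasDerivAt_tan)
    (fun r hr => div_pos (mul_pos (h.tan_pos r hr) (sub_pos.2 (hab r hr)))
      (mul_pos hr.1 (h.rad_pos r hr))) h.tendsto_tan

section HyperbolicCenter

variable (h : IsStretchProfile lam mu c β a b R) (hβ : IsHyperbolicCenter lam mu β) (hc : 0 < c)

include h hβ hc

/-- As long as the radial modulus is positive, it stays above its central value. -/
lemma le_radModulus : ∀ r ∈ Ioo 0 R, radModulus lam mu β β ≤ radModulus lam mu (a r) (b r) := by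
  refine forall_le_of_gap (g := fun r => radModulus lam mu (a r) (b r)) ?_ hβ.radModulus_pos ?_ ?_
  · intro r hr
    have ha := (h.solves r hr).differentiableAt_rad.continuousAt
    have hb := (h.solves r hr).hasDerivAt_tan.continuousAt
    unfold radModulus piolaRad
    exact ContinuousAt.continuousWithinAt (by fun_prop)
  · have hlim : Tendsto (fun r => radModulus lam mu (a r) (b r)) (𝓝[>] 0)
        (𝓝 (radModulus lam mu β β)) := by
      unfold radModulus piolaRad
      exact ((((h.tendsto_rad.pow 2).const_mul _).add ((h.tendsto_tan.pow 2).const_mul _)).sub_const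
        _).div_const 2 |>.add ((h.tendsto_rad.pow 2).const_mul _)
    exact hlim.eventually (lt_mem_nhds hβ.radModulus_pos)
  · intro r hr hpos s hs
    have hab := (h.mono hr.2.le).tan_lt_rad_of_radModulus_pos hβ.moduli hc hpos
    exact hβ.moduli.radModulus_mono hβ.stretch_pos.le
      ((h.mono hr.2.le).lt_tan_of_tan_lt_rad hab s hs).le (hab s hs).le

lemma radModulus_pos : ∀ r ∈ Ioo 0 R, 0 < radModulus lam mu (a r) (b r) :=
  fun r hr => hβ.radModulus_pos.trans_le (h.le_radModulus hβ hc r hr)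

lemma tan_lt_rad : ∀ r ∈ Ioo 0 R, b r < a r :=
  h.tan_lt_rad_of_radModulus_pos hβ.moduli hc (h.radModulus_pos hβ hc)

lemma lt_tan : ∀ r ∈ Ioo 0 R, β < b r := h.lt_tan_of_tan_lt_rad (h.tan_lt_rad hβ hc)

lemma tan_lt_one : ∀ r ∈ Ioo 0 R, b r < 1 := fun r hr => by
  have hab := h.tan_lt_rad hβ hc r hr
  have hb := h.tan_pos r hr
  nlinarith [hβ.moduli.sq_add_two_mul_sq_le_three hb.le hab.le (h.piolaRad_neg r hr).le]

lemma stretchGap_pos : ∀ r ∈ Ioo 0 R, 0 < stretchGap a b r :=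
  fun r hr => div_pos (sub_pos.2 (h.tan_lt_rad hβ hc r hr)) hr.1

/-- The gap `a - b = r w` satisfies `(a - b)' ≤ 2 C r` with `C = gapSlope`. -/
lemma stretchGap_le : ∀ r ∈ Ioo 0 R, stretchGap a b r ≤ gapSlope lam mu c β * r := by
  have hderiv : ∀ r ∈ Ioo 0 R, HasDerivAt (fun s => a s - b s - gapSlope lam mu c β * s ^ 2)
      (r * radField lam mu c r (stretchGap a b r) (b r) - 3 * stretchGap a b r
        - 2 * gapSlope lam mu c β * r) r := fun r hr => by
    obtain ⟨hb, ha⟩ := (solvesStretchSystemAt_iff hr.1.ne' (h.rad_pos r hr).ne'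
      (h.tan_pos r hr).ne' (h.radModulus_pos hβ hc r hr).ne').1 (h.solves r hr)
    refine ((ha.sub hb).sub ((hasDerivAt_pow 2 r).const_mul _)).congr_deriv ?_
    push_cast
    ring
  have hdecr : ∀ r ∈ Ioo 0 R, r * radField lam mu c r (stretchGap a b r) (b r)
      - 3 * stretchGap a b r - 2 * gapSlope lam mu c β * r ≤ 0 := fun r hr => by
    have hw := (h.stretchGap_pos hβ hc r hr).le
    have hV : stretchGap a b r / r * r = stretchGap a b r := div_mul_cancel₀ _ hr.1.ne'
    have hle := mul_le_mul_of_nonneg_left (hβ.radField_le hc hr.1.le hw (h.lt_tan hβ hc r hr).le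
      (div_nonneg hw hr.1.le) hV.ge) hr.1.le
    linarith
  have hlim : Tendsto (fun s => a s - b s - gapSlope lam mu c β * s ^ 2) (𝓝[>] 0) (𝓝 0) := by
    have hsq : Tendsto (fun s : ℝ => gapSlope lam mu c β * s ^ 2) (𝓝[>] 0) (𝓝 0) :=
      tendsto_nhdsWithin_of_tendsto_nhds (Continuous.tendsto' (by fun_prop) _ _ (by simp))
    simpa using (h.tendsto_rad.sub h.tendsto_tan).sub hsq
  intro r hr
  rw [stretchGap, div_le_iff₀ hr.1]
  linarith [le_of_tendsto_nhdsGT_of_deriv_nonpos hderiv hdecr hlim r hr]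

lemma mem_stretchBox : ∀ r ∈ Ioo 0 R,
    ![stretchGap a b r, b r] ∈ stretchBox β (gapSlope lam mu c β * R) := fun r hr =>
  ElasticBall.mem_stretchBox.2 ⟨⟨(h.stretchGap_pos hβ hc r hr).le,
    (h.stretchGap_le hβ hc r hr).trans
      (mul_le_mul_of_nonneg_left hr.2.le (hβ.gapSlope_pos hc).le)⟩,
    (h.lt_tan hβ hc r hr).le, (h.tan_lt_one hβ hc r hr).le⟩

lemma isSingularCauchySolution (hR : 0 < R) : IsSingularCauchySolution ![4, 0] ![0, β]
    (stretchField lam mu c) R fun r => ![stretchGap a b r, b r] where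
  hasDerivAt r hr := by
    have ha := (h.rad_pos r hr).ne'
    have hb := (h.tan_pos r hr).ne'
    have hW := (h.radModulus_pos hβ hc r hr).ne'
    refine Fin.forall_fin_two.2 ⟨?_, ?_⟩
    · simpa [stretchField] using (h.solves r hr).hasDerivAt_stretchGap hr.1.ne' ha hb hW
    · simpa [stretchField] using ((solvesStretchSystemAt_iff hr.1.ne' ha hb hW).1 (h.solves r hr)).1
  tendsto := by
    refine tendsto_pi_nhds.2 (Fin.forall_fin_two.2 ⟨?_, h.tendsto_tan⟩)
    have hlin : Tendsto (fun s : ℝ => gapSlope lam mu c β * s) (𝓝[>] 0) (𝓝 0) :=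
      tendsto_nhdsWithin_of_tendsto_nhds (Continuous.tendsto' (by fun_prop) _ _ (by simp))
    refine tendsto_of_tendsto_of_tendsto_of_le_of_le' tendsto_const_nhds hlin ?_ ?_ <;>
      filter_upwards [Ioo_mem_nhdsGT hR] with s hs
    · exact (h.stretchGap_pos hβ hc s hs).le
    · exact h.stretchGap_le hβ hc s hs

theorem eqOn {a' b' : ℝ → ℝ} (h' : IsStretchProfile lam mu c β a' b' R) :
    EqOn a a' (Ioo 0 R) ∧ EqOn b b' (Ioo 0 R) := by
  obtain ⟨Λ, hΛ⟩ := hβ.exists_lipschitzOnWith_stretchField c R (gapSlope lam mu c β * R)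
  have heq : ∀ r ∈ Ioo 0 R, stretchGap a b r = stretchGap a' b' r ∧ b r = b' r := fun r hr => by
    have hR := hr.1.trans hr.2
    have hvec := (h.isSingularCauchySolution hβ hc hR).eq_of_lipschitzOnWith
      (h'.isSingularCauchySolution hβ hc hR) (fun r hr => hΛ r ⟨hr.1.le, hr.2.le⟩)
      (h.mem_stretchBox hβ hc) (h'.mem_stretchBox hβ hc) hr
    exact ⟨congrFun hvec 0, congrFun hvec 1⟩
  refine ⟨fun r hr => ?_, fun r hr => (heq r hr).2⟩
  rw [← add_mul_stretchGap a b hr.1.ne', (heq r hr).1, (heq r hr).2,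
    add_mul_stretchGap _ _ hr.1.ne']

end HyperbolicCenter

end IsStretchProfile

section Clamp

variable {β Y : ℝ}

/-- Projection onto the box `0 ≤ w ≤ Y`, `β ≤ b ≤ 1`. -/
def stretchClamp (β Y : ℝ) (x : Fin 2 → ℝ) : Fin 2 → ℝ :=
  ![max 0 (min Y (x 0)), max β (min 1 (x 1))]

lemma stretchClamp_mem (hβ : β ≤ 1) (hY : 0 ≤ Y) (x : Fin 2 → ℝ) :
    stretchClamp β Y x ∈ stretchBox β Y :=
  mem_stretchBox.2 ⟨⟨le_max_left _ _, max_le hY (min_le_left _ _)⟩,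
    le_max_left _ _, max_le hβ (min_le_left _ _)⟩

lemma stretchClamp_of_mem {x : Fin 2 → ℝ} (hx : x ∈ stretchBox β Y) : stretchClamp β Y x = x := by
  obtain ⟨⟨hw, hwY⟩, hb, hb1⟩ := mem_stretchBox.1 hx
  refine funext (Fin.forall_fin_two.2 ⟨?_, ?_⟩)
  · rw [stretchClamp, Matrix.cons_val_zero, min_eq_right hwY, max_eq_right hw]
  · rw [stretchClamp, Matrix.cons_val_one, Matrix.cons_val_zero, min_eq_right hb1, max_eq_right hb]

lemma lipschitzWith_stretchClamp (β Y : ℝ) : LipschitzWith 1 (stretchClamp β Y) :=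
  fun x y => edist_pi_le_iff.2 <| Fin.forall_fin_two.2
    ⟨((LipschitzWith.eval 0).const_min Y).const_max 0 x y,
      ((LipschitzWith.eval 1).const_min 1).const_max β x y⟩

lemma continuous_stretchClamp (β : ℝ) :
    Continuous fun p : ℝ × (Fin 2 → ℝ) => stretchClamp β p.1 p.2 :=
  continuous_pi <| Fin.forall_fin_two.2
    ⟨by simp only [stretchClamp]; fun_prop, by simp only [stretchClamp]; fun_prop⟩

variable {lam mu c : ℝ}

/-- The right hand sides `q` of the stretch equations for a solution `singularPrimitive` on
`[0, Z]` of the equations with clamped state. -/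
structure IsClampedSolution (lam mu c β Z : ℝ) (q : ℝ → Fin 2 → ℝ) : Prop where
  continuous : Continuous q
  eq_field : ∀ r ∈ Icc 0 Z, q r = stretchField lam mu c r
    (stretchClamp β (gapSlope lam mu c β * r) (singularPrimitive ![4, 0] ![0, β] q r))

lemma IsHyperbolicCenter.exists_isClampedSolution (hβ : IsHyperbolicCenter lam mu β) (hc : 0 < c)
    (hβ1 : β ≤ 1) {Z : ℝ} (hZ : 0 ≤ Z) : ∃ q, IsClampedSolution lam mu c β Z q := by
  have hC := (hβ.gapSlope_pos hc).le
  set C := gapSlope lam mu c β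
  let P : ℝ → ℝ := fun r => projIcc 0 Z hZ r
  have hP : Continuous P := continuous_subtype_val.comp continuous_projIcc
  have hPmem : ∀ r, P r ∈ Icc 0 Z := fun r => (projIcc 0 Z hZ r).2
  have hmem : ∀ r x, stretchClamp β (C * P r) x ∈ stretchBox β (C * Z) := fun r x =>
    Icc_subset_Icc_right (Pi.le_def.2 <| Fin.forall_fin_two.2
      ⟨mul_le_mul_of_nonneg_left (hPmem r).2 hC, le_rfl⟩)
      (stretchClamp_mem hβ1 (mul_nonneg hC (hPmem r).1) x)
  have hcont : Continuous fun p : ℝ × (Fin 2 → ℝ) =>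
      stretchField lam mu c (P p.1) (stretchClamp β (C * P p.1) p.2) :=
    (hβ.contDiffOn_stretchField c Z (C * Z)).continuousOn.comp_continuous
      (f := fun p : ℝ × (Fin 2 → ℝ) => (P p.1, stretchClamp β (C * P p.1) p.2))
      ((hP.comp continuous_fst).prodMk <| (continuous_stretchClamp β).comp <|
        (continuous_const.mul (hP.comp continuous_fst)).prodMk continuous_snd)
      fun p => mk_mem_prod (hPmem p.1) (hmem p.1 p.2)
  obtain ⟨Λ, hΛ⟩ := hβ.exists_lipschitzOnWith_stretchField c Z (C * Z)
  obtain ⟨q, hq, hqF⟩ := exists_eq_comp_singularPrimitive ![4, 0] ![0, β]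
    (F := fun r x => stretchField lam mu c (P r) (stretchClamp β (C * P r) x)) hZ hcont fun r =>
      lipschitzOnWith_univ.1 <| (hΛ (P r) (hPmem r)).comp
        (lipschitzWith_stretchClamp β (C * P r)).lipschitzOnWith fun x _ => hmem r x
  refine ⟨q, hq, fun r hr => ?_⟩
  have hPr : P r = r := congrArg Subtype.val (projIcc_of_mem hZ hr)
  rw [hqF r hr, hPr]

end Clamp

section Profiles

/-- The tangential stretch of a clamped solution. -/
def tanProfile (β : ℝ) (q : ℝ → Fin 2 → ℝ) (r : ℝ) : ℝ := singularPrimitive ![4, 0] ![0, β] q r 1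

/-- The anisotropy of a clamped solution. -/
def gapProfile (β : ℝ) (q : ℝ → Fin 2 → ℝ) (r : ℝ) : ℝ := singularPrimitive ![4, 0] ![0, β] q r 0

/-- The radial stretch of a clamped solution. -/
def radProfile (β : ℝ) (q : ℝ → Fin 2 → ℝ) (r : ℝ) : ℝ := tanProfile β q r + r * gapProfile β q r

lemma tanProfile_eq (β : ℝ) (q : ℝ → Fin 2 → ℝ) (r : ℝ) :
    tanProfile β q r = β + r * radialAverage 0 (fun s => q s 1) r := rfl

lemma gapProfile_eq (β : ℝ) (q : ℝ → Fin 2 → ℝ) (r : ℝ) :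
    gapProfile β q r = r * radialAverage 4 (fun s => q s 0) r := zero_add _

lemma tanProfile_zero (β : ℝ) (q : ℝ → Fin 2 → ℝ) : tanProfile β q 0 = β := by
  rw [tanProfile_eq, zero_mul, add_zero]

lemma radProfile_zero (β : ℝ) (q : ℝ → Fin 2 → ℝ) : radProfile β q 0 = β := by
  rw [radProfile, tanProfile_zero, zero_mul, add_zero]

lemma stretchGap_profile (β : ℝ) (q : ℝ → Fin 2 → ℝ) {r : ℝ} (hr : r ≠ 0) :
    stretchGap (radProfile β q) (tanProfile β q) r = gapProfile β q r := by
  rw [stretchGap, radProfile, add_sub_cancel_left, mul_div_cancel_left₀ _ hr]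

end Profiles

namespace IsClampedSolution

variable {lam mu c β Z r : ℝ} {q : ℝ → Fin 2 → ℝ} (h : IsClampedSolution lam mu c β Z q)

include h

lemma hasDerivAt_tanProfile (r : ℝ) : HasDerivAt (tanProfile β q) (q r 1) r := by
  have hd := hasDerivAt_mul_radialAverage 0 ((continuous_apply 1).comp h.continuous) r
  rw [Nat.cast_zero, zero_mul, sub_zero] at hd
  exact hd.const_add β

lemma hasDerivAt_radProfile (r : ℝ) :
    HasDerivAt (radProfile β q) (q r 1 + r * q r 0 - 3 * gapProfile β q r) r := by
  have hd := (hasDerivAt_mul_radialAverage 4 ((continuous_apply 0).comp h.continuous) r)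
  simp only [Function.comp_def, ← gapProfile_eq β] at hd
  refine ((h.hasDerivAt_tanProfile r).add ((hasDerivAt_id r).mul hd)).congr_deriv ?_
  rw [gapProfile_eq, id]
  push_cast
  ring

lemma contDiff_tanProfile : ContDiff ℝ 1 (tanProfile β q) :=
  contDiff_one_iff_deriv.2 ⟨fun r => (h.hasDerivAt_tanProfile r).differentiableAt,
    (funext fun r => (h.hasDerivAt_tanProfile r).deriv) ▸ (continuous_apply 1).comp h.continuous⟩

lemma contDiff_radProfile : ContDiff ℝ 1 (radProfile β q) := by
  refine contDiff_one_iff_deriv.2 ⟨fun r => (h.hasDerivAt_radProfile r).differentiableAt, ?_⟩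
  rw [funext fun r => (h.hasDerivAt_radProfile r).deriv]
  have hx := continuous_singularPrimitive ![4, 0] ![0, β] h.continuous
  have hgap : Continuous (gapProfile β q) := (continuous_apply 0).comp hx
  have hq := h.continuous
  fun_prop

section HyperbolicCenter

variable (hβ : IsHyperbolicCenter lam mu β) (hc : 0 < c) (hβ1 : β ≤ 1)

include hβ hc hβ1

lemma radField_mem (hr : r ∈ Icc 0 Z) : q r 0 ∈ Icc 0 (5 * gapSlope lam mu c β) := by
  have hC := (hβ.gapSlope_pos hc).le
  obtain ⟨⟨hw, hwC⟩, hb, -⟩ := mem_stretchBox.1 (stretchClamp_mem hβ1 (mul_nonneg hC hr.1)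
    (singularPrimitive ![4, 0] ![0, β] q r))
  have hb0 := hβ.stretch_pos.trans_le hb
  have hab := le_add_of_nonneg_right (mul_nonneg hr.1 hw) (a := stretchClamp β
    (gapSlope lam mu c β * r) (singularPrimitive ![4, 0] ![0, β] q r) 1)
  rw [h.eq_field r hr]
  refine ⟨(radField_pos hβ.moduli hc (hb0.trans_le hab) hb0 (hβ.radModulus_pos_of_le hb hab)).le,
    (hβ.radField_le hc hr.1 hw hb hC hwC).trans_eq (by ring)⟩

lemma tanField_nonneg (hr : r ∈ Icc 0 Z) : 0 ≤ q r 1 := by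
  obtain ⟨⟨hw, -⟩, hb, -⟩ := mem_stretchBox.1 (stretchClamp_mem hβ1
    (mul_nonneg (hβ.gapSlope_pos hc).le hr.1) (singularPrimitive ![4, 0] ![0, β] q r))
  have hb0 := (hβ.stretch_pos.trans_le hb).le
  rw [h.eq_field r hr]
  exact div_nonneg (mul_nonneg hw hb0) (add_nonneg hb0 (mul_nonneg hr.1 hw))

lemma gapProfile_mem (hr : r ∈ Icc 0 Z) : gapProfile β q r ∈ Icc 0 (gapSlope lam mu c β * r) := by
  have hq : Continuous fun s => q s 0 := (continuous_apply 0).comp h.continuous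
  have hmem := fun s (hs : s ∈ Icc 0 r) => h.radField_mem hβ hc hβ1 ⟨hs.1, hs.2.trans hr.2⟩
  have hlow := radialAverage_mono (k := 4) hr.1 continuous_const hq fun s hs => (hmem s hs).1
  have hupp := radialAverage_mono (k := 4) hr.1 hq continuous_const fun s hs => (hmem s hs).2
  rw [radialAverage_const] at hlow hupp
  rw [gapProfile_eq, mul_comm r]
  exact ⟨mul_nonneg (hlow.trans_eq' (by simp)) hr.1,
    mul_le_mul_of_nonneg_right (hupp.trans_eq (by push_cast; ring)) hr.1⟩

lemma le_tanProfile (hr : r ∈ Icc 0 Z) : β ≤ tanProfile β q r := by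
  have hq : Continuous fun s => q s 1 := (continuous_apply 1).comp h.continuous
  have hlow := radialAverage_mono (k := 0) hr.1 continuous_const hq fun s hs =>
    h.tanField_nonneg hβ hc hβ1 ⟨hs.1, hs.2.trans hr.2⟩
  rw [radialAverage_const, zero_div] at hlow
  exact le_add_of_nonneg_right (mul_nonneg hr.1 hlow)

lemma tanProfile_le_radProfile (hr : r ∈ Icc 0 Z) : tanProfile β q r ≤ radProfile β q r :=
  le_add_of_nonneg_right (mul_nonneg hr.1 (h.gapProfile_mem hβ hc hβ1 hr).1)

section Unclamped

variable (hr : r ∈ Icc 0 Z) (hS : piolaRad lam mu (radProfile β q r) (tanProfile β q r) ≤ 0)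

include hr hS

lemma sq_radProfile_add_le : radProfile β q r ^ 2 + 2 * tanProfile β q r ^ 2 ≤ 3 :=
  hβ.moduli.sq_add_two_mul_sq_le_three
    (hβ.stretch_pos.le.trans (h.le_tanProfile hβ hc hβ1 hr))
    (h.tanProfile_le_radProfile hβ hc hβ1 hr) hS

lemma tanProfile_le_one : tanProfile β q r ≤ 1 := by
  have hab := h.tanProfile_le_radProfile hβ hc hβ1 hr
  have hb := hβ.stretch_pos.trans_le (h.le_tanProfile hβ hc hβ1 hr)
  nlinarith [h.sq_radProfile_add_le hβ hc hβ1 hr hS]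

/-- The clamp is inactive where the radial stress is not positive. -/
lemma eq_stretchField :
    q r 0 = radField lam mu c r (gapProfile β q r) (tanProfile β q r) ∧
      q r 1 = tanField r (gapProfile β q r) (tanProfile β q r) := by
  have hq := h.eq_field r hr
  rw [stretchClamp_of_mem (mem_stretchBox.2 ⟨h.gapProfile_mem hβ hc hβ1 hr,
    h.le_tanProfile hβ hc hβ1 hr, h.tanProfile_le_one hβ hc hβ1 hr hS⟩)] at hq
  exact ⟨congrFun hq 0, congrFun hq 1⟩

lemma le_radField : c / (8 * (lam + 2 * mu)) ≤ q r 0 := by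
  rw [(h.eq_stretchField hβ hc hβ1 hr hS).1]
  exact hβ.le_radField hc hr.1 (h.gapProfile_mem hβ hc hβ1 hr).1 (h.le_tanProfile hβ hc hβ1 hr) hS

lemma solvesStretchSystemAt (hr0 : 0 < r) :
    SolvesStretchSystemAt lam mu c (radProfile β q) (tanProfile β q) r := by
  have hb := h.le_tanProfile hβ hc hβ1 hr
  have hab := h.tanProfile_le_radProfile hβ hc hβ1 hr
  have hb0 := hβ.stretch_pos.trans_le hb
  obtain ⟨hq0, hq1⟩ := h.eq_stretchField hβ hc hβ1 hr hS
  rw [solvesStretchSystemAt_iff hr0.ne' (hb0.trans_le hab).ne' hb0.ne'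
    (hβ.radModulus_pos_of_le hb hab).ne', stretchGap_profile β q hr0.ne', ← hq0, ← hq1]
  exact ⟨h.hasDerivAt_tanProfile r, h.hasDerivAt_radProfile r⟩

end Unclamped

lemma mul_le_gapProfile (hr : r ∈ Icc 0 Z)
    (hS : ∀ s ∈ Icc 0 r, piolaRad lam mu (radProfile β q s) (tanProfile β q s) ≤ 0) :
    c / (40 * (lam + 2 * mu)) * r ≤ gapProfile β q r := by
  have hq : Continuous fun s => q s 0 := (continuous_apply 0).comp h.continuous
  have hlow := radialAverage_mono (k := 4) hr.1 continuous_const hq fun s hs =>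
    h.le_radField hβ hc hβ1 ⟨hs.1, hs.2.trans hr.2⟩ (hS s hs)
  rw [radialAverage_const, div_div] at hlow
  rw [gapProfile_eq, mul_comm]
  refine mul_le_mul_of_nonneg_left (le_of_eq_of_le ?_ hlow) hr.1
  push_cast
  ring_nf

end HyperbolicCenter

end IsClampedSolution

section StretchBall

/-- The stretches of a ball of radius `R` in which the radial pressure vanishes at the boundary
only. -/
structure IsStretchBall (lam mu c β : ℝ) (a b : ℝ → ℝ) (R : ℝ) : Prop where
  radius_pos : 0 < R
  contDiff_rad : ContDiff ℝ 1 a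
  contDiff_tan : ContDiff ℝ 1 b
  rad_zero : a 0 = β
  tan_zero : b 0 = β
  deriv_rad_zero : deriv a 0 = 0
  deriv_tan_zero : deriv b 0 = 0
  lt_tan : ∀ r ∈ Ioc 0 R, β < b r
  tan_lt_rad : ∀ r ∈ Ioc 0 R, b r < a r
  solves : ∀ r ∈ Ioo 0 R, SolvesStretchSystemAt lam mu c a b r
  piolaRad_neg : ∀ r ∈ Ico 0 R, piolaRad lam mu (a r) (b r) < 0
  piolaRad_radius : piolaRad lam mu (a R) (b R) = 0

variable {lam mu c β Z : ℝ} {q : ℝ → Fin 2 → ℝ}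

namespace IsClampedSolution

variable (h : IsClampedSolution lam mu c β Z q) (hβ : IsHyperbolicCenter lam mu β) (hc : 0 < c)
  (hβ1 : β ≤ 1)

include h hβ hc hβ1

/-- Before the radial stress vanishes, `a ≥ r w` grows like `r²`, while `a² < 3`. -/
lemma exists_piolaRad_nonneg (hZ : 1 ≤ Z) (hcZ : 80 * (lam + 2 * mu) ≤ c * Z) :
    ∃ r ∈ Icc 0 Z, 0 ≤ piolaRad lam mu (radProfile β q r) (tanProfile β q r) := by
  by_contra! hneg
  have hL := hβ.moduli.pWave_pos
  have hZmem : Z ∈ Icc 0 Z := right_mem_Icc.2 (zero_le_one.trans hZ)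
  have hw : 2 ≤ gapProfile β q Z := by
    refine le_trans ?_ (h.mul_le_gapProfile hβ hc hβ1 hZmem fun s hs => (hneg s hs).le)
    rw [div_mul_eq_mul_div, le_div_iff₀ (by positivity)]
    linarith
  have hb := hβ.stretch_pos.trans_le (h.le_tanProfile hβ hc hβ1 hZmem)
  have ha : 2 ≤ radProfile β q Z := by
    rw [radProfile]
    nlinarith
  nlinarith [h.sq_radProfile_add_le hβ hc hβ1 hZmem (hneg Z hZmem).le]

lemma gapProfile_zero (hZ : 0 ≤ Z) : gapProfile β q 0 = 0 := by
  simpa using h.gapProfile_mem hβ hc hβ1 (left_mem_Icc.2 hZ)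

lemma gapProfile_pos {r : ℝ} (hr : r ∈ Ioc 0 Z)
    (hS : ∀ s ∈ Icc 0 r, piolaRad lam mu (radProfile β q s) (tanProfile β q s) ≤ 0) :
    0 < gapProfile β q r := by
  have hL := hβ.moduli.pWave_pos
  exact (mul_pos (by positivity) hr.1).trans_le
    (h.mul_le_gapProfile hβ hc hβ1 (Ioc_subset_Icc_self hr) hS)

lemma strictMonoOn_tanProfile {R : ℝ} (hR : R ≤ Z)
    (hS : ∀ r ∈ Icc 0 R, piolaRad lam mu (radProfile β q r) (tanProfile β q r) ≤ 0) :
    StrictMonoOn (tanProfile β q) (Icc 0 R) := by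
  refine strictMonoOn_of_deriv_pos (convex_Icc 0 R) h.contDiff_tanProfile.continuous.continuousOn
    fun r hr => ?_
  rw [interior_Icc] at hr
  have hr0 := hr.1
  have hrZ : r ∈ Icc 0 Z := ⟨hr.1.le, hr.2.le.trans hR⟩
  have hb := hβ.stretch_pos.trans_le (h.le_tanProfile hβ hc hβ1 hrZ)
  have hw := h.gapProfile_pos hβ hc hβ1 ⟨hr.1, hrZ.2⟩ fun s hs => hS s ⟨hs.1, hs.2.trans hr.2.le⟩
  rw [(h.hasDerivAt_tanProfile r).deriv,
    (h.eq_stretchField hβ hc hβ1 hrZ (hS r (Ioo_subset_Icc_self hr))).2, tanField]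
  positivity

lemma isStretchBall {R : ℝ} (hR : R ∈ Ioc 0 Z)
    (hneg : ∀ r ∈ Ico 0 R, piolaRad lam mu (radProfile β q r) (tanProfile β q r) < 0)
    (hzero : piolaRad lam mu (radProfile β q R) (tanProfile β q R) = 0) :
    IsStretchBall lam mu c β (radProfile β q) (tanProfile β q) R := by
  have hmem : ∀ r ∈ Icc 0 R, r ∈ Icc 0 Z := fun r hr => ⟨hr.1, hr.2.trans hR.2⟩
  have hle : ∀ r ∈ Icc 0 R, piolaRad lam mu (radProfile β q r) (tanProfile β q r) ≤ 0 :=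
    fun r hr => hr.2.eq_or_lt.elim (fun h => (h ▸ hzero).le) fun h => (hneg r ⟨hr.1, h⟩).le
  have hmono := h.strictMonoOn_tanProfile hβ hc hβ1 hR.2 hle
  have hzmem : (0 : ℝ) ∈ Icc 0 R := left_mem_Icc.2 hR.1.le
  have hgap0 := h.gapProfile_zero hβ hc hβ1 (hR.1.le.trans hR.2)
  have hq0 : q 0 1 = 0 := by
    rw [(h.eq_stretchField hβ hc hβ1 (hmem 0 hzmem) (hle 0 hzmem)).2, hgap0, tanField, zero_mul,
      zero_div]
  exact
    { radius_pos := hR.1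
      contDiff_rad := h.contDiff_radProfile
      contDiff_tan := h.contDiff_tanProfile
      rad_zero := radProfile_zero β q
      tan_zero := tanProfile_zero β q
      deriv_rad_zero := by
        rw [(h.hasDerivAt_radProfile 0).deriv, hgap0, hq0, zero_mul, mul_zero, add_zero, sub_zero]
      deriv_tan_zero := by rw [(h.hasDerivAt_tanProfile 0).deriv, hq0]
      lt_tan := fun r hr => (tanProfile_zero β q).symm.trans_lt <|
        hmono hzmem (Ioc_subset_Icc_self hr) hr.1
      tan_lt_rad := fun r hr => lt_add_of_pos_right _ <| mul_pos hr.1 <|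
        h.gapProfile_pos hβ hc hβ1 ⟨hr.1, hr.2.trans hR.2⟩ fun s hs => hle s ⟨hs.1, hs.2.trans hr.2⟩
      solves := fun r hr => h.solvesStretchSystemAt hβ hc hβ1 (hmem r (Ioo_subset_Icc_self hr))
        (hle r (Ioo_subset_Icc_self hr)) hr.1
      piolaRad_neg := hneg
      piolaRad_radius := hzero }

end IsClampedSolution

theorem IsHyperbolicCenter.exists_isStretchBall (hβ : IsHyperbolicCenter lam mu β) (hc : 0 < c)
    (hβ1 : β < 1) : ∃ a b R, IsStretchBall lam mu c β a b R := by
  have hL := hβ.moduli.pWave_pos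
  have hbulk := hβ.moduli.bulk_pos
  set Z := 80 * (lam + 2 * mu) / c + 1 with hZdef
  have hZ : 1 ≤ Z := le_add_of_nonneg_left (by positivity)
  have hcZ : 80 * (lam + 2 * mu) ≤ c * Z := by
    rw [hZdef, mul_add_one, mul_div_cancel₀ _ hc.ne']
    linarith
  obtain ⟨q, h⟩ := hβ.exists_isClampedSolution hc hβ1.le (zero_le_one.trans hZ)
  have hcont : Continuous fun r => piolaRad lam mu (radProfile β q r) (tanProfile β q r) := by
    have ha := h.contDiff_radProfile.continuous
    have hb := h.contDiff_tanProfile.continuous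
    unfold piolaRad
    fun_prop
  have hcenter : piolaRad lam mu (radProfile β q 0) (tanProfile β q 0) < 0 := by
    rw [radProfile_zero, tanProfile_zero, piolaRad_self]
    exact mul_neg_of_pos_of_neg (by positivity) (by nlinarith [hβ.stretch_pos])
  obtain ⟨R, hR, hzero, hneg⟩ := exists_first_zero hcont.continuousOn hcenter
    (h.exists_piolaRad_nonneg hβ hc hβ1.le hZ hcZ)
  exact ⟨_, _, R, h.isStretchBall hβ hc hβ1.le hR hneg hzero⟩

end StretchBall

namespace IsRegularBall

variable {rho pRad pTan : ℝ → ℝ} {R K : ℝ} (h : IsRegularBall rho pRad pTan R)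

include h

lemma rho_pos : ∀ r ∈ Ioo 0 R, 0 < rho r := fun r hr => by
  rw [← h.support_eq] at hr
  exact (interior_subset hr).2

lemma continuousOn_mul_sq : ContinuousOn (fun s => rho s * s ^ 2) (Icc 0 R) :=
  h.rho_cont.mul (continuous_pow 2).continuousOn

lemma intervalIntegrable_mul_sq :
    ∀ r ∈ Icc 0 R, IntervalIntegrable (fun s => rho s * s ^ 2) MeasureTheory.volume 0 r :=
  fun _ hr => ContinuousOn.intervalIntegrable_of_Icc hr.1 <|
    h.continuousOn_mul_sq.mono (Icc_subset_Icc_right hr.2)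

lemma hasDerivAt_mass : ∀ r ∈ Ioo 0 R, HasDerivAt (mass rho) (4 * Real.pi * (rho r * r ^ 2)) r :=
  fun r hr => (intervalIntegral.integral_hasDerivAt_right
    (h.intervalIntegrable_mul_sq r (Ioo_subset_Icc_self hr))
    ((h.continuousOn_mul_sq.mono Ioo_subset_Icc_self).stronglyMeasurableAtFilter isOpen_Ioo r hr)
    (h.continuousOn_mul_sq.continuousAt (Icc_mem_nhds hr.1 hr.2))).const_mul _

lemma mass_pos : ∀ r ∈ Ioo 0 R, 0 < mass rho r := fun r hr =>
  mul_pos (by positivity) <| intervalIntegral.intervalIntegral_pos_of_pos_on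
    (h.intervalIntegrable_mul_sq r (Ioo_subset_Icc_self hr))
    (fun s hs => mul_pos (h.rho_pos s ⟨hs.1, hs.2.trans hr.2⟩) (pow_pos hs.1 2)) hr.1

lemma tendsto_mass : Tendsto (mass rho) (𝓝[>] 0) (𝓝 0) := by
  have hprim := intervalIntegral.continuousOn_primitive_interval' (a := 0)
    (h.intervalIntegrable_mul_sq R (right_mem_Icc.2 h.radius_pos.le)) left_mem_uIcc
  rw [uIcc_of_le h.radius_pos.le] at hprim
  have hmass : ContinuousOn (mass rho) (Icc 0 R) := continuousOn_const.mul hprim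
  simpa [mass] using tendsto_nhdsGT_of_continuousOn_Icc h.radius_pos hmass

lemma tendsto_delta (K : ℝ) : Tendsto (delta K rho) (𝓝[>] 0) (𝓝 (rho 0 / K)) :=
  (tendsto_nhdsGT_of_continuousOn_Icc h.radius_pos h.rho_cont).div_const K

lemma tendsto_eta (hK : 0 < K) : Tendsto (eta K rho) (𝓝[>] 0) (𝓝 (rho 0 / K)) := by
  have hvol : ∀ r ∈ Ioo 0 R, HasDerivAt (fun r : ℝ => 4 * Real.pi / 3 * K * r ^ 3)
      (4 * Real.pi * K * r ^ 2) r := fun r _ =>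
    ((hasDerivAt_pow 3 r).const_mul (4 * Real.pi / 3 * K)).congr_deriv (by push_cast; ring)
  have hvol0 : ∀ r ∈ Ioo 0 R, 4 * Real.pi * K * r ^ 2 ≠ 0 := fun r hr => by
    have := hr.1
    positivity
  have hvollim : Tendsto (fun r : ℝ => 4 * Real.pi / 3 * K * r ^ 3) (𝓝[>] 0) (𝓝 0) :=
    tendsto_nhdsWithin_of_tendsto_nhds (Continuous.tendsto' (by fun_prop) _ _ (by simp))
  refine HasDerivAt.lhopital_zero_right_on_Ioo h.radius_pos h.hasDerivAt_mass hvol hvol0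
    h.tendsto_mass hvollim ((h.tendsto_delta K).congr' ?_)
  filter_upwards [self_mem_nhdsWithin] with r hr
  have := (mem_Ioi.1 hr).ne'
  rw [delta]
  field_simp

lemma delta_pos (hK : 0 < K) : ∀ r ∈ Ioo 0 R, 0 < delta K rho r :=
  fun r hr => div_pos (h.rho_pos r hr) hK

lemma eta_pos (hK : 0 < K) : ∀ r ∈ Ioo 0 R, 0 < eta K rho r := fun r hr => by
  have := hr.1
  exact div_pos (h.mass_pos r hr) (by positivity)

lemma hasDerivAt_eta (hK : 0 < K) : ∀ r ∈ Ioo 0 R,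
    HasDerivAt (eta K rho) (3 * (delta K rho r - eta K rho r) / r) r := fun r hr => by
  have hr0 := hr.1
  refine ((h.hasDerivAt_mass r hr).div ((hasDerivAt_pow 3 r).const_mul (4 * Real.pi / 3 * K))
    (by positivity)).congr_deriv ?_
  rw [delta, eta]
  push_cast
  field_simp

section Uniqueness

variable {rho' pRad' pTan' : ℝ → ℝ} {R' : ℝ} (h' : IsRegularBall rho' pRad' pTan' R')

include h'

lemma radius_le (heq : EqOn pRad pRad' (Ioo 0 (min R R'))) : R ≤ R' := by
  by_contra! hlt
  rw [min_eq_right hlt.le] at heq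
  have hclosed : EqOn pRad pRad' (Icc 0 R') := heq.of_subset_closure
    (h.pRad_cont.mono (Icc_subset_Icc_right hlt.le)) h'.pRad_cont Ioo_subset_Icc_self
    (closure_Ioo h'.radius_pos.ne).ge
  have hpos := h.pRad_pos R' ⟨h'.radius_pos.le, hlt⟩
  rw [hclosed (right_mem_Icc.2 h'.radius_pos.le), h'.pRad_boundary] at hpos
  exact hpos.false

theorem eq_of_eqOn_Ioo (hrho : EqOn rho rho' (Ioo 0 (min R R')))
    (hrad : EqOn pRad pRad' (Ioo 0 (min R R'))) (htan : EqOn pTan pTan' (Ioo 0 (min R R'))) :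
    R = R' ∧ ∀ r, 0 ≤ r → rho r = rho' r ∧ pRad r = pRad' r ∧ pTan r = pTan' r := by
  obtain rfl : R = R' :=
    (h.radius_le h' hrad).antisymm (h'.radius_le h (min_comm R R' ▸ hrad.symm))
  rw [min_self] at hrho hrad htan
  have hclosure : Icc 0 R ⊆ closure (Ioo 0 R) := (closure_Ioo h.radius_pos.ne).ge
  refine ⟨rfl, fun r hr => ?_⟩
  rcases le_or_gt r R with hle | hgt
  · exact ⟨hrho.of_subset_closure h.rho_cont h'.rho_cont Ioo_subset_Icc_self hclosure ⟨hr, hle⟩,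
      hrad.of_subset_closure h.pRad_cont h'.pRad_cont Ioo_subset_Icc_self hclosure ⟨hr, hle⟩,
      htan.of_subset_closure h.pTan_cont h'.pTan_cont Ioo_subset_Icc_self hclosure ⟨hr, hle⟩⟩
  · obtain ⟨hρ, hp, hq⟩ := h.vacuum r hgt
    obtain ⟨hρ', hp', hq'⟩ := h'.vacuum r hgt
    exact ⟨hρ.trans hρ'.symm, hp.trans hp'.symm, hq.trans hq'.symm⟩

end Uniqueness

end IsRegularBall

/-- The radial stretch of a ball with density `rho` and reference density `K`. -/
def ballRadStretch (K : ℝ) (rho : ℝ → ℝ) (r : ℝ) : ℝ := radStretch (delta K rho r) (eta K rho r)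

/-- The tangential stretch of a ball with density `rho` and reference density `K`. -/
def ballTanStretch (K : ℝ) (rho : ℝ → ℝ) (r : ℝ) : ℝ := tanStretch (eta K rho r)

lemma rho_mul_mass_div_sq {K r : ℝ} {rho : ℝ → ℝ} (hK : 0 < K) (hr : 0 < r)
    (hd : 0 < delta K rho r) (he : 0 < eta K rho r) :
    rho r * (mass rho r / r ^ 2) =
      4 * Real.pi / 3 * K ^ 2 * r / (ballRadStretch K rho r * ballTanStretch K rho r ^ 5) := by
  have hrho : rho r = K * delta K rho r := (mul_div_cancel₀ _ hK.ne').symm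
  have hmass : mass rho r = 4 * Real.pi / 3 * K * r ^ 3 * eta K rho r :=
    (mul_div_cancel₀ _ (by positivity)).symm
  have hdelta : delta K rho r = 1 / (ballRadStretch K rho r * ballTanStretch K rho r ^ 2) :=
    (one_div_radStretch_mul _ he).symm
  have heta : eta K rho r = 1 / ballTanStretch K rho r ^ 3 := (one_div_tanStretch_pow_three he).symm
  have ha : 0 < ballRadStretch K rho r := radStretch_pos hd he
  have hb : 0 < ballTanStretch K rho r := tanStretch_pos he
  rw [hrho, hmass, hdelta, heta]
  field_simp

namespace IsRegularSVKBall

variable {lam mu K : ℝ} {rho pRad pTan : ℝ → ℝ} {R : ℝ}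
  (h : IsRegularSVKBall lam mu K rho pRad pTan R) (hK : 0 < K)

include h hK

lemma ballRadStretch_pos : ∀ r ∈ Ioo 0 R, 0 < ballRadStretch K rho r :=
  fun r hr => radStretch_pos (h.1.delta_pos hK r hr) (h.1.eta_pos hK r hr)

lemma ballTanStretch_pos : ∀ r ∈ Ioo 0 R, 0 < ballTanStretch K rho r :=
  fun r hr => tanStretch_pos (h.1.eta_pos hK r hr)

lemma pRad_eq : ∀ r ∈ Ioo 0 R,
    pRad r = stretchRad lam mu (ballRadStretch K rho r) (ballTanStretch K rho r) := fun r hr =>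
  (h.2.pRad_eq r hr).trans (svkRad_eq lam mu (h.1.delta_pos hK r hr) (h.1.eta_pos hK r hr))

lemma pTan_eq : ∀ r ∈ Ioo 0 R,
    pTan r = stretchTan lam mu (ballRadStretch K rho r) (ballTanStretch K rho r) := fun r hr =>
  (h.2.pTan_eq r hr).trans (svkTan_eq lam mu (h.1.delta_pos hK r hr) (h.1.eta_pos hK r hr))

lemma piolaRad_neg : ∀ r ∈ Ioo 0 R,
    piolaRad lam mu (ballRadStretch K rho r) (ballTanStretch K rho r) < 0 := fun r hr => by
  have hp := h.1.pRad_pos r (Ioo_subset_Ico_self hr)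
  have ha := h.ballRadStretch_pos hK r hr
  have hb := h.ballTanStretch_pos hK r hr
  rw [h.pRad_eq hK r hr, stretchRad, neg_pos] at hp
  exact neg_of_mul_neg_right hp (by positivity)

lemma piolaTan_neg : ∀ r ∈ Ioo 0 R,
    piolaTan lam mu (ballRadStretch K rho r) (ballTanStretch K rho r) < 0 := fun r hr => by
  have hp := h.1.pTan_pos r (Ioo_subset_Ico_self hr)
  rw [h.pTan_eq hK r hr, stretchTan, neg_pos] at hp
  exact neg_of_div_neg_left hp (h.ballRadStretch_pos hK r hr).le

section Center

variable (hm : AdmissibleModuli lam mu)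

include hm

/-- Positive pressures bound the tangential stretch `b`, hence `η = 1 / b³` from below. -/
lemma center_pos : 0 < rho 0 / K := by
  have hη : ∀ r ∈ Ioo 0 R, 1 ≤ eta K rho r ^ 2 * (3 / 2) ^ 3 := fun r hr => by
    have hb := h.ballTanStretch_pos hK r hr
    have hsq := hm.sq_add_two_mul_sq_lt_three (h.piolaRad_neg hK r hr) (h.piolaTan_neg hK r hr)
    have hb2 : ballTanStretch K rho r ^ 2 ≤ 3 / 2 := by
      linarith [sq_nonneg (ballRadStretch K rho r)]
    calc 1 = eta K rho r ^ 2 * (ballTanStretch K rho r ^ 2) ^ 3 := by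
          rw [← one_div_tanStretch_pow_three (h.1.eta_pos hK r hr), ← ballTanStretch]
          field_simp
      _ ≤ eta K rho r ^ 2 * (3 / 2) ^ 3 := by gcongr
  have hIoo := Ioo_mem_nhdsGT h.1.radius_pos
  have hne : 1 ≤ (rho 0 / K) ^ 2 * (3 / 2) ^ 3 :=
    ge_of_tendsto (((h.1.tendsto_eta hK).pow 2).mul_const _) (eventually_of_mem hIoo hη)
  have hnonneg : 0 ≤ rho 0 / K := ge_of_tendsto (h.1.tendsto_delta K)
    (eventually_of_mem hIoo fun r hr => (h.1.delta_pos hK r hr).le)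
  refine hnonneg.lt_of_ne' fun hzero => ?_
  norm_num [hzero] at hne

lemma tendsto_ballTanStretch :
    Tendsto (ballTanStretch K rho) (𝓝[>] 0) (𝓝 (tanStretch (rho 0 / K))) :=
  (hasDerivAt_tanStretch (h.center_pos hK hm)).continuousAt.tendsto.comp (h.1.tendsto_eta hK)

lemma tendsto_ballRadStretch :
    Tendsto (ballRadStretch K rho) (𝓝[>] 0) (𝓝 (tanStretch (rho 0 / K))) := by
  have hδ := h.center_pos hK hm
  rw [← radStretch_self hδ]
  exact ((h.1.tendsto_eta hK).mul (h.tendsto_ballTanStretch hK hm)).div (h.1.tendsto_delta K) hδ.ne'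

lemma pRad_zero : pRad 0 =
    stretchRad lam mu (tanStretch (rho 0 / K)) (tanStretch (rho 0 / K)) := by
  have ha := h.tendsto_ballRadStretch hK hm
  have hb := h.tendsto_ballTanStretch hK hm
  have hβ := tanStretch_pos (h.center_pos hK hm)
  have hlim : Tendsto (fun r => stretchRad lam mu (ballRadStretch K rho r) (ballTanStretch K rho r))
      (𝓝[>] 0) (𝓝 (stretchRad lam mu (tanStretch (rho 0 / K)) (tanStretch (rho 0 / K)))) :=
    ((ha.div (hb.pow 2) (by positivity)).mul ((((ha.pow 2).const_mul _).add
      ((hb.pow 2).const_mul _)).sub_const _ |>.div_const 2)).neg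
  refine tendsto_nhds_unique (tendsto_nhdsGT_of_continuousOn_Icc h.1.radius_pos h.1.pRad_cont)
    (hlim.congr' ?_)
  filter_upwards [Ioo_mem_nhdsGT h.1.radius_pos] with r hr
  exact (h.pRad_eq hK r hr).symm

theorem one_lt_center : 1 < rho 0 / K := by
  have hδ := h.center_pos hK hm
  have hβ := tanStretch_pos hδ
  have hp := h.1.pRad_pos 0 (left_mem_Ico.2 h.1.radius_pos)
  rw [h.pRad_zero hK hm, stretchRad, piolaRad_self, neg_pos] at hp
  have hsq := neg_of_mul_neg_right (neg_of_mul_neg_right hp (by positivity))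
    (half_pos hm.bulk_pos).le
  rw [← tanStretch_lt_one_iff hδ]
  exact (sq_lt_one_iff₀ hβ.le).1 (sub_neg.1 hsq)

end Center

lemma solvesStretchSystemAt : ∀ r ∈ Ioo 0 R, SolvesStretchSystemAt lam mu
    (4 * Real.pi / 3 * K ^ 2) (ballRadStretch K rho) (ballTanStretch K rho) r := fun r hr => by
  have hd := h.1.delta_pos hK r hr
  have he := h.1.eta_pos hK r hr
  have hb := (hasDerivAt_tanStretch he).comp r (h.1.hasDerivAt_eta hK r hr)
  have hrho : DifferentiableAt ℝ rho r :=
    (h.1.rho_C1.differentiableOn one_ne_zero r (Ioo_subset_Ioc_self hr)).differentiableAt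
      (Ioc_mem_nhds hr.1 hr.2)
  refine ⟨((h.1.hasDerivAt_eta hK r hr).differentiableAt.mul hb.differentiableAt).div
    (hrho.div_const K) hd.ne', hb.congr_deriv ?_, ?_⟩
  · have hr0 := hr.1
    have := tanStretch_pos he
    rw [ballRadStretch, ballTanStretch, radStretch]
    field_simp
    ring
  · obtain ⟨Phi, hPhi⟩ := h.1.system
    obtain ⟨hPhi, hp⟩ := hPhi r hr
    rw [hPhi.deriv, rho_mul_mass_div_sq hK hr.1 hd he, h.pRad_eq hK r hr, h.pTan_eq hK r hr] at hp
    exact hp.congr_of_eventuallyEq <| eventually_of_mem (Ioo_mem_nhds hr.1 hr.2)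
      fun s hs => (h.pRad_eq hK s hs).symm

lemma isStretchProfile (hm : AdmissibleModuli lam mu) : IsStretchProfile lam mu
    (4 * Real.pi / 3 * K ^ 2) (tanStretch (rho 0 / K)) (ballRadStretch K rho)
    (ballTanStretch K rho) R where
  rad_pos := h.ballRadStretch_pos hK
  tan_pos := h.ballTanStretch_pos hK
  solves := h.solvesStretchSystemAt hK
  tendsto_rad := h.tendsto_ballRadStretch hK hm
  tendsto_tan := h.tendsto_ballTanStretch hK hm
  piolaRad_neg := h.piolaRad_neg hK

theorem unique (hβ : IsHyperbolicCenter lam mu (tanStretch (rho 0 / K)))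
    {rho' pRad' pTan' : ℝ → ℝ} {R' : ℝ} (h' : IsRegularSVKBall lam mu K rho' pRad' pTan' R')
    (hcenter : rho 0 = rho' 0) :
    R = R' ∧ ∀ r, 0 ≤ r → rho r = rho' r ∧ pRad r = pRad' r ∧ pTan r = pTan' r := by
  have hprofile := (h.isStretchProfile hK hβ.moduli).mono (min_le_left R R')
  have hprofile' := (h'.isStretchProfile hK hβ.moduli).mono (min_le_right R R')
  rw [← hcenter] at hprofile'
  obtain ⟨ha, hb⟩ := hprofile.eqOn hβ (by positivity) hprofile'
  have hR : ∀ r ∈ Ioo 0 (min R R'), r ∈ Ioo 0 R :=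
    fun r hr => Ioo_subset_Ioo_right (min_le_left R R') hr
  have hR' : ∀ r ∈ Ioo 0 (min R R'), r ∈ Ioo 0 R' :=
    fun r hr => Ioo_subset_Ioo_right (min_le_right R R') hr
  refine h.1.eq_of_eqOn_Ioo h'.1 (fun r hr => ?_) (fun r hr => ?_) fun r hr => ?_
  · have hδ : delta K rho r = delta K rho' r := by
      rw [← one_div_radStretch_mul (delta K rho r) (h.1.eta_pos hK r (hR r hr)),
        ← one_div_radStretch_mul (delta K rho' r) (h'.1.eta_pos hK r (hR' r hr)),
        ← ballRadStretch, ← ballRadStretch, ← ballTanStretch, ← ballTanStretch, ha hr, hb hr]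
    exact (div_left_inj' hK.ne').1 hδ
  · rw [h.pRad_eq hK r (hR r hr), h'.pRad_eq hK r (hR' r hr), ha hr, hb hr]
  · rw [h.pTan_eq hK r (hR r hr), h'.pTan_eq hK r (hR' r hr), ha hr, hb hr]

end IsRegularSVKBall

/-- The field with the value `G (a r) (b r)` inside the ball of radius `R` with the radial and
tangential stretches `a, b`, and zero outside. -/
def ballField (G : ℝ → ℝ → ℝ) (a b : ℝ → ℝ) (R : ℝ) : ℝ → ℝ :=
  (Iic R).indicator fun r => G (a r) (b r)

/-- The density of a material with reference density `K` at the stretches `a, b`. -/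
def stretchDensity (K a b : ℝ) : ℝ := K / (a * b ^ 2)

section BallField

variable {G : ℝ → ℝ → ℝ} {a b : ℝ → ℝ} {R r : ℝ}

lemma ballField_of_le (G : ℝ → ℝ → ℝ) (a b : ℝ → ℝ) (hr : r ≤ R) :
    ballField G a b R r = G (a r) (b r) :=
  indicator_of_mem (mem_Iic.2 hr) _

lemma ballField_of_lt (G : ℝ → ℝ → ℝ) (a b : ℝ → ℝ) (hr : R < r) : ballField G a b R r = 0 :=
  indicator_of_notMem (notMem_Iic.2 hr) _

lemma ballField_eventuallyEq (G : ℝ → ℝ → ℝ) (a b : ℝ → ℝ) (hr : r < R) :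
    ballField G a b R =ᶠ[𝓝 r] fun s => G (a s) (b s) :=
  eventually_of_mem (Iio_mem_nhds hr) fun _ hs => ballField_of_le G a b (mem_Iio.1 hs).le

lemma contDiffOn_ballField (hG : ContDiffOn ℝ 1 (fun q : ℝ × ℝ => G q.1 q.2) (Ioi 0 ×ˢ Ioi 0))
    (ha : ContDiff ℝ 1 a) (hb : ContDiff ℝ 1 b)
    (hpos : ∀ r ∈ Icc 0 R, 0 < a r ∧ 0 < b r) : ContDiffOn ℝ 1 (ballField G a b R) (Icc 0 R) :=
  (hG.comp (ha.prodMk hb).contDiffOn hpos).congr fun _ hr => ballField_of_le G a b hr.2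

lemma tendsto_deriv_ballField
    (hG : ContDiffOn ℝ 1 (fun q : ℝ × ℝ => G q.1 q.2) (Ioi 0 ×ˢ Ioi 0))
    (ha : ContDiff ℝ 1 a) (hb : ContDiff ℝ 1 b) (hR : 0 < R) (ha0 : 0 < a 0) (hb0 : 0 < b 0)
    (ha' : deriv a 0 = 0) (hb' : deriv b 0 = 0) :
    Tendsto (deriv (ballField G a b R)) (𝓝[>] 0) (𝓝 0) := by
  have hG0 : ContDiffAt ℝ 1 (fun q : ℝ × ℝ => G q.1 q.2) (a 0, b 0) :=
    hG.contDiffAt (prod_mem_nhds (Ioi_mem_nhds ha0) (Ioi_mem_nhds hb0))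
  have hcomp : ContDiffAt ℝ 1 (fun r => G (a r) (b r)) 0 :=
    hG0.comp (0 : ℝ) (f := fun r => (a r, b r)) (ha.prodMk hb).contDiffAt
  have hcenter : deriv (fun r => G (a r) (b r)) 0 = 0 := by
    have hab := (ha.differentiable one_ne_zero 0).hasDerivAt.prodMk
      (hb.differentiable one_ne_zero 0).hasDerivAt
    rw [ha', hb', Prod.mk_zero_zero] at hab
    exact ((hG0.differentiableAt one_ne_zero).hasFDerivAt.comp_hasDerivAt 0 hab).deriv.trans
      (map_zero _)
  have hlim : Tendsto (deriv fun r => G (a r) (b r)) (𝓝[>] 0) (𝓝 0) := by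
    have hcont := (hcomp.derivWithin (m := 0) le_rfl).continuousAt
    have := hcont.tendsto.mono_left (nhdsWithin_le_nhds (s := Ioi 0))
    rwa [hcenter] at this
  refine hlim.congr' ?_
  filter_upwards [Ioo_mem_nhdsGT hR] with r hr
  exact (ballField_eventuallyEq G a b hr.2).deriv_eq.symm

end BallField

lemma contDiffOn_stretchDensity (K : ℝ) :
    ContDiffOn ℝ 1 (fun q : ℝ × ℝ => stretchDensity K q.1 q.2) (Ioi 0 ×ˢ Ioi 0) :=
  ContDiffOn.div (by fun_prop) (by fun_prop) fun _ hq =>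
    (mul_pos (mem_Ioi.1 hq.1) (pow_pos (mem_Ioi.1 hq.2) 2)).ne'

lemma delta_ballField {K : ℝ} {a b : ℝ → ℝ} {R r : ℝ} (hK : K ≠ 0) (hr : r ≤ R) :
    delta K (ballField (stretchDensity K) a b R) r = 1 / (a r * b r ^ 2) := by
  rw [delta, ballField_of_le _ _ _ hr, stretchDensity]
  field_simp

namespace IsStretchBall

variable {lam mu c β K : ℝ} {a b : ℝ → ℝ} {R : ℝ} (h : IsStretchBall lam mu c β a b R)

include h

section Stretches

lemma tan_le_rad : ∀ r ∈ Icc 0 R, b r ≤ a r := fun r hr => by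
  rcases hr.1.eq_or_lt with rfl | h0
  · exact (h.tan_zero.trans h.rad_zero.symm).le
  · exact (h.tan_lt_rad r ⟨h0, hr.2⟩).le

lemma tan_pos (hβ : 0 < β) : ∀ r ∈ Icc 0 R, 0 < b r := fun r hr => by
  rcases hr.1.eq_or_lt with rfl | h0
  · exact h.tan_zero.symm ▸ hβ
  · exact hβ.trans (h.lt_tan r ⟨h0, hr.2⟩)

lemma rad_pos (hβ : 0 < β) : ∀ r ∈ Icc 0 R, 0 < a r :=
  fun r hr => (h.tan_pos hβ r hr).trans_le (h.tan_le_rad r hr)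

lemma tan_lt_one (hm : AdmissibleModuli lam mu) (hβ : 0 < β) : ∀ r ∈ Ioc 0 R, b r < 1 :=
  fun r hr => by
  have hb := h.tan_pos hβ r (Ioc_subset_Icc_self hr)
  have hab := h.tan_lt_rad r hr
  have hpiola : piolaRad lam mu (a r) (b r) ≤ 0 := by
    rcases hr.2.eq_or_lt with rfl | hlt
    · exact h.piolaRad_radius.le
    · exact (h.piolaRad_neg r ⟨hr.1.le, hlt⟩).le
  have hsq : b r ^ 2 < a r ^ 2 := by gcongr
  exact (sq_lt_one_iff₀ hb.le).1
    (by linarith [hm.sq_add_two_mul_sq_le_three hb.le hab.le hpiola])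

end Stretches

section Fields

variable (hβ : 0 < β)

include hβ

lemma contDiffOn_ballField {G : ℝ → ℝ → ℝ}
    (hG : ContDiffOn ℝ 1 (fun q : ℝ × ℝ => G q.1 q.2) (Ioi 0 ×ˢ Ioi 0)) :
    ContDiffOn ℝ 1 (ballField G a b R) (Icc 0 R) :=
  ElasticBall.contDiffOn_ballField hG h.contDiff_rad h.contDiff_tan
    fun r hr => ⟨h.rad_pos hβ r hr, h.tan_pos hβ r hr⟩

lemma tendsto_deriv_ballField {G : ℝ → ℝ → ℝ}
    (hG : ContDiffOn ℝ 1 (fun q : ℝ × ℝ => G q.1 q.2) (Ioi 0 ×ˢ Ioi 0)) :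
    Tendsto (deriv (ballField G a b R)) (𝓝[>] 0) (𝓝 0) :=
  ElasticBall.tendsto_deriv_ballField hG h.contDiff_rad h.contDiff_tan h.radius_pos
    (h.rad_zero.symm ▸ hβ) (h.tan_zero.symm ▸ hβ) h.deriv_rad_zero h.deriv_tan_zero

lemma density_pos (hK : 0 < K) :
    ∀ r ∈ Icc 0 R, 0 < ballField (stretchDensity K) a b R r := fun r hr => by
  have := h.rad_pos hβ r hr
  have := h.tan_pos hβ r hr
  rw [ballField_of_le _ _ _ hr.2, stretchDensity]
  positivity

/-- The tangential stretch `b` moves the reference ball of radius `r / b` to the ball of radius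
`r`, which therefore contains the mass `(4π/3) K (r / b)³`. -/
lemma mass_ballField (K : ℝ) : ∀ r ∈ Icc 0 R,
    mass (ballField (stretchDensity K) a b R) r = 4 * Real.pi / 3 * (K / b r ^ 3) * r ^ 3 :=
  fun r hr => by
  have hb : ∀ s ∈ Icc 0 r, 0 < b s :=
    fun s hs => h.tan_pos hβ s (Icc_subset_Icc_right hr.2 hs)
  have hcont : ContinuousOn (fun s => K / 3 * s ^ 3 / b s ^ 3) (Icc 0 r) :=
    ContinuousOn.div (by fun_prop) (h.contDiff_tan.continuous.pow 3).continuousOn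
      fun s hs => (pow_pos (hb s hs) 3).ne'
  have hderiv : ∀ s ∈ Ioo 0 r, HasDerivAt (fun s => K / 3 * s ^ 3 / b s ^ 3)
      (ballField (stretchDensity K) a b R s * s ^ 2) s := fun s hs => by
    have hsR : s ∈ Ioo 0 R := Ioo_subset_Ioo_right hr.2 hs
    have hs0 := hs.1
    have hbs := hb s (Ioo_subset_Icc_self hs)
    have has := h.rad_pos hβ s (Ioo_subset_Icc_self hsR)
    refine (((hasDerivAt_pow 3 s).const_mul (K / 3)).div ((h.solves s hsR).hasDerivAt_tan.pow 3)
      (pow_pos hbs 3).ne').congr_deriv ?_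
    rw [ballField_of_le _ _ _ hsR.2.le, stretchDensity, Pi.pow_apply]
    push_cast
    field_simp
    ring
  have hint : IntervalIntegrable (fun s => ballField (stretchDensity K) a b R s * s ^ 2)
      MeasureTheory.volume 0 r := by
    refine ContinuousOn.intervalIntegrable_of_Icc hr.1 (ContinuousOn.mul ?_ (by fun_prop))
    exact (h.contDiffOn_ballField hβ (contDiffOn_stretchDensity K)).continuousOn.mono
      (Icc_subset_Icc_right hr.2)
  rw [mass, intervalIntegral.integral_eq_sub_of_hasDerivAt_of_le hr.1 hcont hderiv hint]
  ring

lemma eta_ballField (hK : K ≠ 0) : ∀ r ∈ Ioc 0 R,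
    eta K (ballField (stretchDensity K) a b R) r = 1 / b r ^ 3 := fun r hr => by
  have hr0 := hr.1
  have := h.tan_pos hβ r (Ioc_subset_Icc_self hr)
  rw [eta, h.mass_ballField hβ K r (Ioc_subset_Icc_self hr)]
  field_simp

lemma ballTanStretch_ballField (hK : K ≠ 0) : ∀ r ∈ Ioc 0 R,
    ballTanStretch K (ballField (stretchDensity K) a b R) r = b r := fun r hr => by
  rw [ballTanStretch, h.eta_ballField hβ hK r hr,
    tanStretch_one_div_pow_three (h.tan_pos hβ r (Ioc_subset_Icc_self hr))]

lemma ballRadStretch_ballField (hK : K ≠ 0) : ∀ r ∈ Ioc 0 R,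
    ballRadStretch K (ballField (stretchDensity K) a b R) r = a r := fun r hr => by
  rw [ballRadStretch, delta_ballField hK hr.2, h.eta_ballField hβ hK r hr, radStretch_one_div
    (h.rad_pos hβ r (Ioc_subset_Icc_self hr)) (h.tan_pos hβ r (Ioc_subset_Icc_self hr))]

lemma delta_pos (hK : 0 < K) : ∀ r ∈ Ioc 0 R,
    0 < delta K (ballField (stretchDensity K) a b R) r :=
  fun r hr => div_pos (h.density_pos hβ hK r (Ioc_subset_Icc_self hr)) hK

lemma eta_pos (hK : K ≠ 0) : ∀ r ∈ Ioc 0 R,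
    0 < eta K (ballField (stretchDensity K) a b R) r := fun r hr => by
  have := h.tan_pos hβ r (Ioc_subset_Icc_self hr)
  rw [h.eta_ballField hβ hK r hr]
  positivity

lemma interior_support_density (hK : 0 < K) :
    interior {r | 0 < r ∧ 0 < ballField (stretchDensity K) a b R r} = Ioo 0 R := by
  rw [← interior_Ioc]
  congr 1
  ext r
  refine ⟨fun ⟨hr, hpos⟩ => ⟨hr, ?_⟩, fun hr =>
    ⟨hr.1, h.density_pos hβ hK r (Ioc_subset_Icc_self hr)⟩⟩
  contrapose! hpos
  exact (ballField_of_lt _ _ _ hpos).le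

lemma exists_hasDerivAt_potential (K : ℝ) : ∃ Phi : ℝ → ℝ, ∀ r ∈ Ioo 0 R,
    HasDerivAt Phi (mass (ballField (stretchDensity K) a b R) r / r ^ 2) r := by
  have hcont : ContinuousOn (fun s => 4 * Real.pi / 3 * (K / b s ^ 3) * s) (Icc 0 R) :=
    (continuousOn_const.mul (continuousOn_const.div (h.contDiff_tan.continuous.pow 3).continuousOn
      fun s hs => (pow_pos (h.tan_pos hβ s hs) 3).ne')).mul continuousOn_id
  refine ⟨fun r => ∫ s in (0 : ℝ)..r, 4 * Real.pi / 3 * (K / b s ^ 3) * s, fun r hr => ?_⟩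
  have hr0 := hr.1
  refine (intervalIntegral.integral_hasDerivAt_right
    (ContinuousOn.intervalIntegrable_of_Icc hr.1.le (hcont.mono (Icc_subset_Icc_right hr.2.le)))
    ((hcont.mono Ioo_subset_Icc_self).stronglyMeasurableAtFilter isOpen_Ioo r hr)
    (hcont.continuousAt (Icc_mem_nhds hr.1 hr.2))).congr_deriv ?_
  rw [h.mass_ballField hβ K r (Ioo_subset_Icc_self hr)]
  field_simp

lemma stretchRad_pos : ∀ r ∈ Ico 0 R, 0 < stretchRad lam mu (a r) (b r) := fun r hr => by
  have ha := h.rad_pos hβ r (Ico_subset_Icc_self hr)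
  have hb := h.tan_pos hβ r (Ico_subset_Icc_self hr)
  exact neg_pos.2 (mul_neg_of_pos_of_neg (by positivity) (h.piolaRad_neg r hr))

lemma stretchTan_pos (hm : AdmissibleModuli lam mu) :
    ∀ r ∈ Ico 0 R, 0 < stretchTan lam mu (a r) (b r) := fun r hr => by
  have hr' := Ico_subset_Icc_self hr
  have hpiola : piolaTan lam mu (a r) (b r) < 0 :=
    (hm.piolaTan_le_piolaRad (h.tan_pos hβ r hr').le (h.tan_le_rad r hr')).trans_lt
      (h.piolaRad_neg r hr)
  exact neg_pos.2 (div_neg_of_neg_of_pos hpiola (h.rad_pos hβ r hr'))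

end Fields

lemma hasDerivAt_ballField_stretchRad {r : ℝ} (hr : r ∈ Ioo 0 R) :
    HasDerivAt (ballField (stretchRad lam mu) a b R)
      (-(2 / r) * (stretchRad lam mu (a r) (b r) - stretchTan lam mu (a r) (b r))
        - c * r / (a r * b r ^ 5)) r :=
  (h.solves r hr).balance.congr_of_eventuallyEq (ballField_eventuallyEq _ _ _ hr.2)

lemma density_zero (K : ℝ) : ballField (stretchDensity K) a b R 0 = K / β ^ 3 := by
  rw [ballField_of_le _ _ _ h.radius_pos.le, stretchDensity, h.rad_zero, h.tan_zero]
  ring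

lemma strictlyHyperbolicAt (hβ : IsHyperbolicCenter lam mu β) (hK : 0 < K) : ∀ r ∈ Ioc 0 R,
    StrictlyHyperbolicAt (svkRad lam mu) (delta K (ballField (stretchDensity K) a b R) r)
      (eta K (ballField (stretchDensity K) a b R) r) := fun r hr => by
  have hβ0 := hβ.stretch_pos
  rw [strictlyHyperbolicAt_iff lam mu (h.delta_pos hβ0 hK r hr) (h.eta_pos hβ0 hK.ne' r hr),
    ← ballRadStretch, ← ballTanStretch, h.ballRadStretch_ballField hβ0 hK.ne' r hr,
    h.ballTanStretch_ballField hβ0 hK.ne' r hr]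
  exact hβ.radModulus_pos_of_le (h.lt_tan r hr).le (h.tan_lt_rad r hr).le

section Bounds

variable (hβ : 0 < β) (hK : 0 < K)

include hβ hK

lemma density_lt : ∀ r ∈ Ioc 0 R, ballField (stretchDensity K) a b R r < K / b r ^ 3 :=
  fun r hr => by
  have hb := h.tan_pos hβ r (Ioc_subset_Icc_self hr)
  rw [ballField_of_le _ _ _ hr.2, stretchDensity, pow_succ' (b r) 2]
  have := h.tan_lt_rad r hr
  gcongr

lemma div_tan_pow_three_lt : ∀ r ∈ Ioc 0 R, K / b r ^ 3 < K / β ^ 3 := fun r hr => by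
  have := h.lt_tan r hr
  gcongr

lemma density_lt_center : ∀ r ∈ Ioc 0 R, ballField (stretchDensity K) a b R r < K / β ^ 3 :=
  fun r hr => (h.density_lt hβ hK r hr).trans (h.div_tan_pow_three_lt hβ hK r hr)

lemma mass_lt : ∀ r ∈ Ioc 0 R, mass (ballField (stretchDensity K) a b R) r <
    4 * Real.pi / 3 * (K / β ^ 3) * r ^ 3 := fun r hr => by
  have hr0 := hr.1
  rw [h.mass_ballField hβ K r (Ioc_subset_Icc_self hr)]
  have := h.div_tan_pow_three_lt hβ hK r hr
  gcongr

lemma lt_mass (hm : AdmissibleModuli lam mu) : ∀ r ∈ Ioc 0 R,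
    4 * Real.pi / 3 * max (ballField (stretchDensity K) a b R r) K * r ^ 3 <
      mass (ballField (stretchDensity K) a b R) r := fun r hr => by
  have hr0 := hr.1
  have hb := h.tan_pos hβ r (Ioc_subset_Icc_self hr)
  have hb1 := pow_lt_one₀ hb.le (h.tan_lt_one hm hβ r hr) three_ne_zero
  rw [h.mass_ballField hβ K r (Ioc_subset_Icc_self hr)]
  have := max_lt (h.density_lt hβ hK r hr)
    ((lt_div_iff₀ (by positivity)).2 (mul_lt_of_lt_one_right hK hb1))
  gcongr

end Bounds

end IsStretchBall

namespace IsStretchBall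

variable {lam mu β K : ℝ} {a b : ℝ → ℝ} {R : ℝ}
  (h : IsStretchBall lam mu (4 * Real.pi / 3 * K ^ 2) β a b R)

include h

lemma solvesStaticSystem (hβ : 0 < β) (hK : 0 < K) :
    SolvesStaticSystem (ballField (stretchDensity K) a b R)
      (ballField (stretchRad lam mu) a b R) (ballField (stretchTan lam mu) a b R) R := by
  obtain ⟨Phi, hPhi⟩ := h.exists_hasDerivAt_potential hβ K
  refine ⟨Phi, fun r hr => ⟨hPhi r hr, (h.hasDerivAt_ballField_stretchRad hr).congr_deriv ?_⟩⟩
  have hr' := Ioo_subset_Ioc_self hr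
  rw [(hPhi r hr).deriv, rho_mul_mass_div_sq hK hr.1 (h.delta_pos hβ hK r hr')
    (h.eta_pos hβ hK.ne' r hr'), h.ballRadStretch_ballField hβ hK.ne' r hr',
    h.ballTanStretch_ballField hβ hK.ne' r hr', ballField_of_le _ _ _ hr.2.le,
    ballField_of_le _ _ _ hr.2.le]

lemma isRegularBall (hm : AdmissibleModuli lam mu) (hβ : 0 < β) (hK : 0 < K) :
    IsRegularBall (ballField (stretchDensity K) a b R) (ballField (stretchRad lam mu) a b R)
      (ballField (stretchTan lam mu) a b R) R := by
  have hrho := h.contDiffOn_ballField hβ (contDiffOn_stretchDensity K)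
  have hrad := h.contDiffOn_ballField hβ (contDiffOn_stretchRad lam mu)
  have htan := h.contDiffOn_ballField hβ (contDiffOn_stretchTan lam mu)
  exact {
    radius_pos := h.radius_pos
    support_eq := h.interior_support_density hβ hK
    rho_cont := hrho.continuousOn
    pRad_cont := hrad.continuousOn
    pTan_cont := htan.continuousOn
    rho_C1 := hrho.mono Ioc_subset_Icc_self
    pRad_C1 := hrad.mono Ioc_subset_Icc_self
    pTan_C1 := htan.mono Ioc_subset_Icc_self
    system := h.solvesStaticSystem hβ hK
    pRad_pos := fun r hr => by
      rw [ballField_of_le _ _ _ hr.2.le]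
      exact h.stretchRad_pos hβ r hr
    pTan_pos := fun r hr => by
      rw [ballField_of_le _ _ _ hr.2.le]
      exact h.stretchTan_pos hβ hm r hr
    pRad_boundary := by
      rw [ballField_of_le _ _ _ le_rfl, stretchRad, h.piolaRad_radius, mul_zero, neg_zero]
    center_eq := by
      rw [ballField_of_le _ _ _ h.radius_pos.le, ballField_of_le _ _ _ h.radius_pos.le,
        h.rad_zero, h.tan_zero, stretchRad_self_eq_stretchTan]
    vacuum := fun r hr =>
      ⟨ballField_of_lt _ _ _ hr, ballField_of_lt _ _ _ hr, ballField_of_lt _ _ _ hr⟩ }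

lemma isStronglyRegularBall (hm : AdmissibleModuli lam mu) (hβ : 0 < β) (hK : 0 < K) :
    IsStronglyRegularBall (ballField (stretchDensity K) a b R)
      (ballField (stretchRad lam mu) a b R) (ballField (stretchTan lam mu) a b R) R where
  toIsRegularBall := h.isRegularBall hm hβ hK
  rho_C1_closed := h.contDiffOn_ballField hβ (contDiffOn_stretchDensity K)
  pRad_C1_closed := h.contDiffOn_ballField hβ (contDiffOn_stretchRad lam mu)
  pTan_C1_closed := h.contDiffOn_ballField hβ (contDiffOn_stretchTan lam mu)
  rho_deriv_center := h.tendsto_deriv_ballField hβ (contDiffOn_stretchDensity K)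
  pRad_deriv_center := h.tendsto_deriv_ballField hβ (contDiffOn_stretchRad lam mu)
  pTan_deriv_center := h.tendsto_deriv_ballField hβ (contDiffOn_stretchTan lam mu)

lemma hasConstitutiveFunctions (hβ : 0 < β) (hK : 0 < K) :
    HasConstitutiveFunctions (svkRad lam mu) (svkTan lam mu) K
      (ballField (stretchDensity K) a b R) (ballField (stretchRad lam mu) a b R)
      (ballField (stretchTan lam mu) a b R) R where
  cRad_C1 := contDiffOn_svkRad lam mu
  cTan_C1 := contDiffOn_svkTan lam mu
  pRad_eq := fun r hr => by
    have hr' := Ioo_subset_Ioc_self hr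
    rw [svkRad_eq lam mu (h.delta_pos hβ hK r hr') (h.eta_pos hβ hK.ne' r hr'), ← ballRadStretch,
      ← ballTanStretch, h.ballRadStretch_ballField hβ hK.ne' r hr',
      h.ballTanStretch_ballField hβ hK.ne' r hr', ballField_of_le _ _ _ hr.2.le]
  pTan_eq := fun r hr => by
    have hr' := Ioo_subset_Ioc_self hr
    rw [svkTan_eq lam mu (h.delta_pos hβ hK r hr') (h.eta_pos hβ hK.ne' r hr'), ← ballRadStretch,
      ← ballTanStretch, h.ballRadStretch_ballField hβ hK.ne' r hr',
      h.ballTanStretch_ballField hβ hK.ne' r hr', ballField_of_le _ _ _ hr.2.le]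

theorem isStronglyRegularSVKBall (hm : AdmissibleModuli lam mu) (hβ : 0 < β) (hK : 0 < K) :
    IsStronglyRegularSVKBall lam mu K (ballField (stretchDensity K) a b R)
      (ballField (stretchRad lam mu) a b R) (ballField (stretchTan lam mu) a b R) R :=
  ⟨h.isStronglyRegularBall hm hβ hK, h.hasConstitutiveFunctions hβ hK⟩

end IsStretchBall

end ElasticBall

end

theorem theorem4 (lam mu : ℝ) (hmu : 0 ≤ mu) (hbulk : 0 < 3 * lam + 2 * mu) :
    -- necessity of `δ_c > 1` for the existence of regular balls
    (∀ (K : ℝ) (rho pRad pTan : ℝ → ℝ) (R : ℝ), 0 < K →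
      ElasticBall.IsRegularSVKBall lam mu K rho pRad pTan R → 1 < rho 0 / K) ∧
    -- necessity of `δ_c < Δ_♭` for strict hyperbolicity at the center
    (∀ K rhoc : ℝ, 0 < K → 0 < rhoc →
      ElasticBall.StrictlyHyperbolicAt (ElasticBall.svkRad lam mu) (rhoc / K) (rhoc / K) →
      rhoc / K < ElasticBall.deltaFlat lam mu) ∧
    -- existence, uniqueness and bounds
    (∀ K rhoc : ℝ, 0 < K → 0 < rhoc → 1 < rhoc / K →
      rhoc / K < ElasticBall.deltaFlat lam mu →
      ElasticBall.StrictlyHyperbolicAt (ElasticBall.svkRad lam mu) (rhoc / K) (rhoc / K) ∧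
      ∃ (rho pRad pTan : ℝ → ℝ) (R : ℝ),
        ElasticBall.IsStronglyRegularSVKBall lam mu K rho pRad pTan R ∧
        rho 0 = rhoc ∧
        (∀ (rho' pRad' pTan' : ℝ → ℝ) (R' : ℝ),
          ElasticBall.IsRegularSVKBall lam mu K rho' pRad' pTan' R' → rho' 0 = rhoc →
          R' = R ∧ ∀ r, 0 ≤ r → rho' r = rho r ∧ pRad' r = pRad r ∧ pTan' r = pTan r) ∧
        (∀ r ∈ Set.Ioc 0 R,
          ElasticBall.StrictlyHyperbolicAt (ElasticBall.svkRad lam mu)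
            (ElasticBall.delta K rho r) (ElasticBall.eta K rho r) ∧
          rho r < rhoc ∧
          4 * Real.pi / 3 * max (rho r) K * r ^ 3 < ElasticBall.mass rho r ∧
          ElasticBall.mass rho r < 4 * Real.pi / 3 * rhoc * r ^ 3)) := by
  have hm : ElasticBall.AdmissibleModuli lam mu := ⟨hmu, hbulk⟩
  refine ⟨fun K rho pRad pTan R hK h => h.one_lt_center hK hm,
    fun K rhoc hK hrhoc => (hm.strictlyHyperbolicAt_self_iff (div_pos hrhoc hK)).1,
    fun K rhoc hK hrhoc hgt hlt => ?_⟩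
  have hδ : 0 < rhoc / K := div_pos hrhoc hK
  have hβ := ElasticBall.IsHyperbolicCenter.of_lt_deltaFlat hm hδ hlt
  obtain ⟨a, b, R, h⟩ := hβ.exists_isStretchBall (c := 4 * Real.pi / 3 * K ^ 2) (by positivity)
    ((ElasticBall.tanStretch_lt_one_iff hδ).2 hgt)
  have hball := h.isStronglyRegularSVKBall hm hβ.stretch_pos hK
  have hrhoc := ElasticBall.div_tanStretch_pow_three hK hrhoc
  have hcenter := (h.density_zero K).trans hrhoc
  refine ⟨(hm.strictlyHyperbolicAt_self_iff hδ).2 hlt, _, _, _, R, hball, hcenter,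
    fun rho' pRad' pTan' R' h' hcenter' => ?_, fun r hr => ⟨?_, ?_, ?_, ?_⟩⟩
  · exact h'.unique hK (hcenter'.symm ▸ hβ) ⟨hball.1.1, hball.2⟩ (hcenter'.trans hcenter.symm)
  · exact h.strictlyHyperbolicAt hβ hK r hr
  · exact (h.density_lt_center hβ.stretch_pos hK r hr).trans_eq hrhoc
  · exact h.lt_mass hβ.stretch_pos hK hm r hr
  · exact (h.mass_lt hβ.stretch_pos hK r hr).trans_eq (by rw [hrhoc])
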